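/- **Setting.** A *complete M-monoid* $(K,+,0,\Omega)$ is a commutative monoid $(K,+,0)$ together with a sum $\sum_{i\in I}a_i$ for every countable family in $K$ that coincides with $+$ for finite $I$ and satisfies $\sum_{i\in I}a_i=\sum_{j\in J}\sum_{i\in I_j}a_i$ for every partition $I=\bigcup_{j\in J}I_j$ with countable $J$, and a set $\Omega=\bigcup_k\Omega^{(k)}$ of finitary operations on $K$ that contains all constant zero operations $0_k$ and all of whose members are absorptive ($\omega(a_1,\dots,a_k)=0$ if some $a_i=0$). $K$ is *compressible* if $\mathrm{id}_K\in\Omega^{(1)}$; $\omega\circ\omega'\in\Omega^{(k)}$ for all $k\ge 0$, $\omega\in\Omega^{(1)}$, $\omega'\in\Omega^{(k)}$; $\sum_{i\in I}\omega_i\in\Omega^{(1)}$ (pointwise sum) for every countable family in $\Omega^{(1)}$; and every $\omega\in\Omega^{(k)}$, $k\ge1$, commutes with countable sums in all its arguments, i.e. $\omega(\sum_{i_1\in I_1}a_{i_1},\dots,\sum_{i_k\in I_k}a_{i_k})=\sum_{i_1\in I_1}\cdots\sum_{i_k\in I_k}\omega(a_{i_1},\dots,a_{i_k})$. A *ranked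 alphabet* $\Theta$ is a finite set of symbols with ranks in $\mathbb N$, at least one of rank $0$; $\Theta^{(k)}$ is its set of symbols of rank $k$, $\mathrm{maxrk}(\Theta)$ its maximal rank, and $T_\Theta$ the set of trees over $\Theta$, with positions $\mathrm{pos}(\xi)\subseteq\{1,2,\dots\}^*$. **M-expressions.** $\mathrm{MSO}(\Theta)$-formulas are built from $\mathrm{label}_\sigma(x)$, $\mathrm{edge}_i(x,y)$ ($\sigma\in\Theta$, $1\le i\le\mathrm{maxrk}(\Theta)$) and $x\in X$ by $\neg,\vee,\wedge$ and first- and second-order quantification over positions and sets of positions, with the usual semantics on trees. *M-expressions* over $(\Theta,K)$ are generated by $E::=\mathrm H(\omega)\mid(E+E)\mid(\varphi\rhd E)\mid\sum_xE\mid\sum_XE$, where $\varphi\in\mathrm{MSO}(\Theta)$ and $\omega$ assigns, for some finite set $\mathcal U$ of variables, to every pair $(\sigma,V)\in\Theta^{(k)}\times\mathcal P(\mathcal U)$ an operation in $\Omega^{(k)}$; the free variables of $\mathrm H(\omega)$ are those in $\mathcal U$, the free variables of $\varphi\rhd E$ are those of $\varphi$ and of $E$, and $\sum_x,\sum_X$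 bind $x$, $X$. The value at a tree $\xi$ and an assignment $\rho$ is: for $\mathrm H(\omega)$, the value under the $\omega$-homomorphism into $K$ of the tree obtained from $\xi$ by labelling each position $w$ with $(\xi(w),V_w)$, where $V_w\subseteq\mathcal U$ consists of the $x$ with $\rho(x)=w$ and the $X$ with $w\in\rho(X)$; for $E_1+E_2$, the sum of the values; for $\varphi\rhd E$, the value of $E$ if $(\xi,\rho)\models\varphi$, and $0$ otherwise; for $\sum_xE$ and $\sum_XE$, the sum of the values of $E$ over all $\rho[x\mapsto w]$ with $w\in\mathrm{pos}(\xi)$, respectively all $\rho[X\mapsto W]$ with $W\subseteq\mathrm{pos}(\xi)$. A *sentence* $e$ is an M-expression without free variables; it defines $[\![e]\!]:T_\Theta\to K$. **Definability with storage.** A *storage type* $S=(C,P,F,c_0)$ consists of a set $C$, an element $c_0\in C$, a non-empty set $P$ of functions $C\to\{0,1\}$ and a non-empty set $F$ of partial functions $C\to C$. Let $\Sigma$ be a ranked alphabet. For finite non-empty $P'\subseteq P$, $F'\subseteq F$ let $\Delta$ be the ranked alphabet with $\Delta^{(k)}=P'\times(F')^k$ for $0\le k\le\mathrm{maxrk}(\Sigma)$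 and no symbols of higher rank. Let $*\notin\Sigma$, and let $\langle\Delta,\Sigma\rangle$ be the ranked alphabet with $\langle\Delta,\Sigma\rangle^{(1)}=\Delta^{(1)}\times(\Sigma^{(1)}\cup\{*\})$ and $\langle\Delta,\Sigma\rangle^{(k)}=\Delta^{(k)}\times\Sigma^{(k)}$ for $k\ne1$. A tree $b\in T_\Delta$ is a *$\Delta$-behaviour* if there are configurations $c_w\in C$ ($w\in\mathrm{pos}(b)$) with $c_\varepsilon=c_0$ such that, whenever $b(w)=(p,f_1\dots f_k)$, $p(c_w)=1$ and each $f_i(c_w)$ is defined and equal to $c_{wi}$. For $\xi\in T_\Sigma$ let $\mathcal B_\Delta(\xi)$ be the set of all $\zeta\in T_{\langle\Delta,\Sigma\rangle}$ whose first projection is a $\Delta$-behaviour and to which $\xi$ can be rewritten, in any number of steps and at any positions, by the rules $\sigma(x_1,\dots,x_k)\to\langle d,*\rangle(\sigma(x_1,\dots,x_k))$ with $d\in\Delta^{(1)}$ and $\sigma(x_1,\dots,x_k)\to\langle d,\sigma\rangle(x_1,\dots,x_k)$ with $d\in\Delta^{(k)}$, for $\sigma\in\Sigma^{(k)}$, $k\ge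 0$. A mapping $s:T_\Sigma\to K$ is *$(S,\Sigma,K)$-definable* if for some such $P'$, $F'$ there is a sentence $e$ over $(\langle\Delta,\Sigma\rangle,K)$ with $s(\xi)=\sum_{\zeta\in\mathcal B_\Delta(\xi)}[\![e]\!](\zeta)$ for all $\xi\in T_\Sigma$. The *trivial storage type* is $\mathrm{TRIV}=(\{c\},\{\mathrm{true}_{\{c\}}\},\{\mathrm{id}_{\{c\}}\},c)$, where $\mathrm{true}_{\{c\}}$ is the predicate that is always $1$. **Theorem.** Let $K$ be a complete M-monoid, $\Sigma$ a ranked alphabet, and $s:T_\Sigma\to K$ a weighted tree language. 1. If $s=[\![e]\!]$ for some M-expression sentence $e$ over $(\Sigma,K)$, then $s$ is $(\mathrm{TRIV},\Sigma,K)$-definable. 2. If $K$ is compressible and $s$ is $(\mathrm{TRIV},\Sigma,K)$-definable, then $s=[\![e]\!]$ for some M-expression sentence $e$ over $(\Sigma,K)$. -/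

import Mathlib

universe u

namespace WTL

/-! ### Complete multioperator monoids -/

/-- A complete commutative monoid: besides the finite sums there is a sum for every family with a
countable index set.  It coincides with the finite sum on finite index sets and satisfies the
partition law (the blocks of the partition of `I` are the fibres of `π : I → J`). -/
class CompleteAddMonoid (K : Type u) extends AddCommMonoid K where
  csum : {I : Type} → [Countable I] → (I → K) → K
  csum_of_fintype : ∀ {I : Type} [Fintype I] (f : I → K), csum f = ∑ i, f i
  csum_partition : ∀ {I J : Type} [Countable I] [Countable J] (π : I → J) (f : I → K),
    csum f = csum fun j : J => csum fun i : {i : I // π i = j} => f i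

open CompleteAddMonoid (csum)

/-- The `k`-ary operations on `K`. -/
abbrev Op (K : Type u) (k : ℕ) : Type u := (Fin k → K) → K

/-- A complete multioperator monoid `(K, +, 0, Ω)`; `Ops k` is the set of the `k`-ary operations
that belong to `Ω`.  It contains the constant zero operations, and every operation in it is
absorptive. -/
class CompleteMMonoid (K : Type u) extends CompleteAddMonoid K where
  Ops : (k : ℕ) → Set (Op K k)
  zero_mem : ∀ k : ℕ, (fun _ => 0 : Op K k) ∈ Ops k
  absorptive : ∀ (k : ℕ), ∀ ω ∈ Ops k, ∀ (a : Fin k → K) (i : Fin k), a i = 0 → ω a = 0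

open CompleteMMonoid (Ops)

/-- A `k`-ary operation is completely distributive if it commutes with countable sums in all its
arguments.  The iterated sum over `I 0, …, I (k-1)` is written as one sum over the (countable)
product of these index sets. -/
def CompletelyDistributive {K : Type u} [CompleteAddMonoid K] {k : ℕ} (ω : Op K k) : Prop :=
  ∀ (I : Fin k → Type) [∀ j, Countable (I j)] (a : (j : Fin k) → I j → K),
    ω (fun j => csum (a j)) = csum fun i : ((j : Fin k) → I j) => ω fun j => a j (i j)

/-- `K` has identity, is `(1,*)`-composition closed, completely 1-sum closed and completely
distributive. -/
structure Compressible (K : Type u) [CompleteMMonoid K] : Prop where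
  identity : (fun a => a 0 : Op K 1) ∈ Ops (K := K) 1
  composition : ∀ (k : ℕ), ∀ ω ∈ Ops (K := K) 1, ∀ ω' ∈ Ops (K := K) k,
    (fun a => ω fun _ => ω' a : Op K k) ∈ Ops (K := K) k
  oneSum : ∀ (I : Type) [Countable I] (ω : I → Op K 1), (∀ i, ω i ∈ Ops (K := K) 1) →
    (fun a => csum fun i => ω i a : Op K 1) ∈ Ops (K := K) 1
  distributive : ∀ (k : ℕ), 1 ≤ k → ∀ ω ∈ Ops (K := K) k, CompletelyDistributive ω

/-! ### Ranked alphabets and trees -/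

/-- A ranked alphabet: a finite set of ranked symbols with at least one symbol of rank 0. -/
structure RankedAlphabet : Type 1 where
  carrier : Type
  rk : carrier → ℕ
  finite : Finite carrier
  exists_nullary : ∃ a, rk a = 0

attribute [instance] RankedAlphabet.finite

/-- The maximal rank that occurs (a supremum of a finite set of natural numbers). -/
noncomputable def RankedAlphabet.maxrk (A : RankedAlphabet) : ℕ := ⨆ a, A.rk a

/-- The disjoint union of two ranked alphabets. -/
abbrev RankedAlphabet.sum (A B : RankedAlphabet) : RankedAlphabet where
  carrier := A.carrier ⊕ B.carrier
  rk := Sum.elim A.rk B.rk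
  finite := inferInstance
  exists_nullary := A.exists_nullary.elim fun a ha => ⟨Sum.inl a, ha⟩

/-- The set `T_A` of trees over the ranked alphabet `A`. -/
inductive RTree (A : RankedAlphabet) : Type
  | node (a : A.carrier) (c : Fin (A.rk a) → RTree A) : RTree A

namespace RTree

variable {A B : RankedAlphabet}

/-- The tree relabeling induced by a rank preserving mapping on symbols. -/
def map (f : A.carrier → B.carrier) (hf : ∀ a, B.rk (f a) = A.rk a) : RTree A → RTree B
  | node a c => node (f a) fun i => map f hf (c (Fin.cast (hf a) i))

/-- The positions of a tree, as sequences of numbers `≥ 1`. -/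
def pos : RTree A → Finset (List ℕ)
  | node _ c => insert [] (Finset.univ.biUnion fun i => (pos (c i)).image (List.cons (i.val + 1)))

/-- The label of a tree at a position (`none` if the sequence is not a position of the tree). -/
def labelAt : RTree A → List ℕ → Option A.carrier
  | node a _, [] => some a
  | node _ _, 0 :: _ => none
  | node a c, (n + 1) :: w => if h : n < A.rk a then labelAt (c ⟨n, h⟩) w else none

/-- The unique homomorphism from the term algebra `T_A` to the `A`-algebra `(K, ω)`. -/
def hom {K : Type u} (ω : (a : A.carrier) → Op K (A.rk a)) : RTree A → K
  | node a c => ω a fun i => hom ω (c i)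

/-- Trees over `A`, as elements of a W-type. -/
def toW : RTree A → WType fun a : A.carrier => Fin (A.rk a)
  | node a c => WType.mk a fun i => toW (c i)

theorem toW_injective : Function.Injective (toW (A := A)) := by
  intro s
  induction s with
  | node a c ih =>
    rintro ⟨b, d⟩ h
    simp only [toW, WType.mk.injEq] at h
    obtain ⟨rfl, h⟩ := h
    congr 1
    funext i
    exact ih i (congrFun (eq_of_heq h) i)

instance instCountable : Countable (RTree A) := by
  have : Encodable A.carrier := Encodable.ofCountable _
  exact toW_injective.countable

end RTree

/-! ### Monadic second-order logic on trees -/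

/-- Variables: `Sum.inl n` are the first-order, `Sum.inr n` the second-order variables. -/
abbrev Var : Type := ℕ ⊕ ℕ

/-- Assignments of positions to first-order and of finite sets of positions to second-order
variables. -/
structure Assignment : Type where
  fo : ℕ → List ℕ
  so : ℕ → Finset (List ℕ)

namespace Assignment

def updFO (ρ : Assignment) (x : ℕ) (w : List ℕ) : Assignment :=
  { ρ with fo := Function.update ρ.fo x w }

def updSO (ρ : Assignment) (X : ℕ) (W : Finset (List ℕ)) : Assignment :=
  { ρ with so := Function.update ρ.so X W }

/-- Under the assignment, the variable labels the position `w`. -/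
def Marks (ρ : Assignment) (w : List ℕ) : Var → Prop
  | Sum.inl x => ρ.fo x = w
  | Sum.inr X => w ∈ ρ.so X

/-- All first-order variables are at the root, all second-order variables are empty. It is used
only for sentences, whose semantics does not depend on the assignment. -/
def default : Assignment where
  fo _ := []
  so _ := ∅

/-- Two assignments agree on a set of variables. -/
def Agree (V : Finset Var) (ρ ρ' : Assignment) : Prop :=
  (∀ x, Sum.inl x ∈ V → ρ.fo x = ρ'.fo x) ∧ (∀ X, Sum.inr X ∈ V → ρ.so X = ρ'.so X)

theorem Agree.mono {V V' : Finset Var} {ρ ρ' : Assignment} (h : Agree V' ρ ρ') (hV : V ⊆ V') :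
    Agree V ρ ρ' :=
  ⟨fun x hx => h.1 x (hV hx), fun X hX => h.2 X (hV hX)⟩

theorem Agree.updFO {V : Finset Var} {ρ ρ' : Assignment} {x : ℕ}
    (h : Agree (V.erase (Sum.inl x)) ρ ρ') (w : List ℕ) :
    Agree V (ρ.updFO x w) (ρ'.updFO x w) := by
  refine ⟨fun y hy => ?_, fun Y hY => ?_⟩
  · by_cases hxy : y = x
    · subst hxy
      simp [Assignment.updFO]
    · simpa [Assignment.updFO, hxy] using h.1 y (by simp [hxy, hy])
  · exact h.2 Y (by simp [hY])

theorem Agree.updSO {V : Finset Var} {ρ ρ' : Assignment} {X : ℕ}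
    (h : Agree (V.erase (Sum.inr X)) ρ ρ') (W : Finset (List ℕ)) :
    Agree V (ρ.updSO X W) (ρ'.updSO X W) := by
  refine ⟨fun y hy => ?_, fun Y hY => ?_⟩
  · exact h.1 y (by simp [hy])
  · by_cases hXY : Y = X
    · subst hXY
      simp [Assignment.updSO]
    · simpa [Assignment.updSO, hXY] using h.2 Y (by simp [hXY, hY])

end Assignment

/-- Formulas of MSO-logic over `A`; in `edge i x y` the index `i` stands for `i + 1`, which ranges
over `1, …, maxrk A`. -/
inductive MSO (A : RankedAlphabet) : Type
  | label (a : A.carrier) (x : ℕ) : MSO A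
  | edge (i : Fin A.maxrk) (x y : ℕ) : MSO A
  | mem (x X : ℕ) : MSO A
  | not (φ : MSO A) : MSO A
  | or (φ ψ : MSO A) : MSO A
  | and (φ ψ : MSO A) : MSO A
  | existsFO (x : ℕ) (φ : MSO A) : MSO A
  | forallFO (x : ℕ) (φ : MSO A) : MSO A
  | existsSO (X : ℕ) (φ : MSO A) : MSO A
  | forallSO (X : ℕ) (φ : MSO A) : MSO A

namespace MSO

variable {A : RankedAlphabet}

/-- Free variables. -/
def free : MSO A → Finset Var
  | label _ x => {Sum.inl x}
  | edge _ x y => {Sum.inl x, Sum.inl y}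
  | mem x X => {Sum.inl x, Sum.inr X}
  | not φ => φ.free
  | or φ ψ => φ.free ∪ ψ.free
  | and φ ψ => φ.free ∪ ψ.free
  | existsFO x φ => φ.free.erase (Sum.inl x)
  | forallFO x φ => φ.free.erase (Sum.inl x)
  | existsSO X φ => φ.free.erase (Sum.inr X)
  | forallSO X φ => φ.free.erase (Sum.inr X)

/-- The pair of the tree `ξ` and the assignment `ρ` is a model of the formula. -/
def Models (ξ : RTree A) : MSO A → Assignment → Prop
  | label a x, ρ => ξ.labelAt (ρ.fo x) = some a
  | edge i x y, ρ => ρ.fo y = ρ.fo x ++ [i.val + 1]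
  | mem x X, ρ => ρ.fo x ∈ ρ.so X
  | not φ, ρ => ¬ φ.Models ξ ρ
  | or φ ψ, ρ => φ.Models ξ ρ ∨ ψ.Models ξ ρ
  | and φ ψ, ρ => φ.Models ξ ρ ∧ ψ.Models ξ ρ
  | existsFO x φ, ρ => ∃ w ∈ ξ.pos, φ.Models ξ (ρ.updFO x w)
  | forallFO x φ, ρ => ∀ w ∈ ξ.pos, φ.Models ξ (ρ.updFO x w)
  | existsSO X φ, ρ => ∃ W ⊆ ξ.pos, φ.Models ξ (ρ.updSO X W)
  | forallSO X φ, ρ => ∀ W ⊆ ξ.pos, φ.Models ξ (ρ.updSO X W)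

theorem models_congr (ξ : RTree A) (φ : MSO A) : ∀ {ρ ρ' : Assignment},
    Assignment.Agree φ.free ρ ρ' → (φ.Models ξ ρ ↔ φ.Models ξ ρ') := by
  induction φ with
  | label a x =>
    intro ρ ρ' h
    simp only [Models, h.1 x (by simp [free])]
  | edge i x y =>
    intro ρ ρ' h
    simp only [Models, h.1 x (by simp [free]), h.1 y (by simp [free])]
  | mem x X =>
    intro ρ ρ' h
    simp only [Models, h.1 x (by simp [free]), h.2 X (by simp [free])]
  | not φ ih =>
    intro ρ ρ' h
    exact not_congr (ih h)
  | or φ ψ ih₁ ih₂ =>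
    intro ρ ρ' h
    exact or_congr (ih₁ (h.mono Finset.subset_union_left))
      (ih₂ (h.mono Finset.subset_union_right))
  | and φ ψ ih₁ ih₂ =>
    intro ρ ρ' h
    exact and_congr (ih₁ (h.mono Finset.subset_union_left))
      (ih₂ (h.mono Finset.subset_union_right))
  | existsFO x φ ih =>
    intro ρ ρ' h
    exact exists_congr fun w => and_congr_right fun _ => ih (h.updFO w)
  | forallFO x φ ih =>
    intro ρ ρ' h
    exact forall₂_congr fun w _ => ih (h.updFO w)
  | existsSO X φ ih =>
    intro ρ ρ' h
    exact exists_congr fun W => and_congr_right fun _ => ih (h.updSO W)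
  | forallSO X φ ih =>
    intro ρ ρ' h
    exact forall₂_congr fun W _ => ih (h.updSO W)

end MSO

/-! ### M-expressions -/

/-- The ranked alphabet `A_U` of pairs of a symbol of `A` and a subset of `U`. -/
abbrev RankedAlphabet.ext (A : RankedAlphabet) (U : Finset Var) : RankedAlphabet where
  carrier := A.carrier × Set U
  rk p := A.rk p.1
  finite := inferInstance
  exists_nullary := A.exists_nullary.elim fun a ha => ⟨(a, ∅), ha⟩

/-- The tree over `A_U` that encodes a tree and an assignment restricted to the variables in `U`;
`w` is the position of the root of the tree in the whole tree. -/
def RTree.encode {A : RankedAlphabet} (U : Finset Var) (ρ : Assignment) :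
    List ℕ → RTree A → RTree (A.ext U)
  | w, node a c =>
    node (A := A.ext U) (a, {v : U | ρ.Marks w v}) fun i => encode U ρ (w ++ [i.val + 1]) (c i)

theorem RTree.encode_congr {A : RankedAlphabet} {U : Finset Var} {ρ ρ' : Assignment}
    (h : Assignment.Agree U ρ ρ') (ξ : RTree A) :
    ∀ w : List ℕ, RTree.encode U ρ w ξ = RTree.encode U ρ' w ξ := by
  induction ξ with
  | node a c ih =>
    intro w
    have hs : {v : U | ρ.Marks w v} = {v : U | ρ'.Marks w v} := by
      ext ⟨v, hv⟩
      rcases v with x | X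
      · simp [Assignment.Marks, h.1 x hv]
      · simp [Assignment.Marks, h.2 X hv]
    have hc : (fun i : Fin (A.rk a) => RTree.encode U ρ (w ++ [i.val + 1]) (c i)) =
        fun i => RTree.encode U ρ' (w ++ [i.val + 1]) (c i) := funext fun i => ih i _
    show RTree.node (A := A.ext U) (a, {v : U | ρ.Marks w v}) _ =
      RTree.node (A := A.ext U) (a, {v : U | ρ'.Marks w v}) _
    rw [hc, hs]

/-- M-expressions over `(A, K)`: `H(ω)` for an `A_U`-family `ω` of operations in `Ω`, `E + E`,
`φ ▷ E`, `∑_x E` and `∑_X E`. -/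
inductive MExp (A : RankedAlphabet) (K : Type u) [CompleteMMonoid K] : Type u
  | H (U : Finset Var)
      (ω : (a : (A.ext U).carrier) → Ops (K := K) ((A.ext U).rk a)) : MExp A K
  | add (e₁ e₂ : MExp A K) : MExp A K
  | guard (φ : MSO A) (e : MExp A K) : MExp A K
  | sumFO (x : ℕ) (e : MExp A K) : MExp A K
  | sumSO (X : ℕ) (e : MExp A K) : MExp A K

namespace MExp

variable {A : RankedAlphabet} {K : Type u} [CompleteMMonoid K]

/-- Free variables. -/
def free : MExp A K → Finset Var
  | H U _ => U
  | add e₁ e₂ => e₁.free ∪ e₂.free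
  | guard φ e => φ.free ∪ e.free
  | sumFO x e => e.free.erase (Sum.inl x)
  | sumSO X e => e.free.erase (Sum.inr X)

/-- A sentence is an M-expression without free variables. -/
def IsSentence (e : MExp A K) : Prop := e.free = ∅

open Classical in
/-- The value of an M-expression at a tree and an assignment. -/
noncomputable def eval (ξ : RTree A) : MExp A K → Assignment → K
  | H U ω, ρ => (RTree.encode U ρ [] ξ).hom fun a => (ω a).val
  | add e₁ e₂, ρ => e₁.eval ξ ρ + e₂.eval ξ ρ
  | guard φ e, ρ => if φ.Models ξ ρ then e.eval ξ ρ else 0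
  | sumFO x e, ρ => ∑ w ∈ ξ.pos, e.eval ξ (ρ.updFO x w)
  | sumSO X e, ρ => ∑ W ∈ ξ.pos.powerset, e.eval ξ (ρ.updSO X W)

open Classical in
theorem eval_congr (ξ : RTree A) (e : MExp A K) : ∀ {ρ ρ' : Assignment},
    Assignment.Agree e.free ρ ρ' → e.eval ξ ρ = e.eval ξ ρ' := by
  induction e with
  | H U ω =>
    intro ρ ρ' h
    exact congrArg (RTree.hom fun a => (ω a).val) (RTree.encode_congr (U := U) h ξ [])
  | add e₁ e₂ ih₁ ih₂ =>
    intro ρ ρ' h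
    simp only [eval, ih₁ (h.mono Finset.subset_union_left),
      ih₂ (h.mono Finset.subset_union_right)]
  | guard φ e ih =>
    intro ρ ρ' h
    exact if_congr (MSO.models_congr ξ φ (h.mono Finset.subset_union_left))
      (ih (h.mono Finset.subset_union_right)) rfl
  | sumFO x e ih =>
    intro ρ ρ' h
    exact Finset.sum_congr rfl fun w _ => ih (h.updFO w)
  | sumSO X e ih =>
    intro ρ ρ' h
    exact Finset.sum_congr rfl fun W _ => ih (h.updSO W)

/-- The semantics of a sentence does not depend on the assignment. -/
theorem IsSentence.eval_eq {e : MExp A K} (he : e.IsSentence) (ξ : RTree A) (ρ ρ' : Assignment) :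
    e.eval ξ ρ = e.eval ξ ρ' := by
  have h : e.free = ∅ := he
  exact eval_congr ξ e ⟨by simp [h], by simp [h]⟩

/-- The weighted tree language defined by a sentence. -/
noncomputable def sem (e : MExp A K) (ξ : RTree A) : K := e.eval ξ Assignment.default

end MExp

/-! ### Storage types and behaviours -/

/-- A storage type: configurations, an initial configuration, a non-empty set of predicates, and a
non-empty set of partial functions (instructions). -/
structure StorageType : Type 1 where
  C : Type
  P : Set (C → Bool)
  F : Set (C → Option C)
  c₀ : C
  P_nonempty : P.Nonempty
  F_nonempty : F.Nonempty

/-- The trivial storage type: one configuration, the always true predicate, the identity. -/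
def TRIV : StorageType where
  C := Unit
  P := {fun _ => true}
  F := {fun c => some c}
  c₀ := ()
  P_nonempty := Set.singleton_nonempty _
  F_nonempty := Set.singleton_nonempty _

/-- The ranked alphabet `n`-corresponding to the finite sets `P'` of predicates and `F'` of
instructions: its symbols of rank `k ≤ n` are the tuples `(p, f₁ ⋯ f_k)`. -/
abbrev corresponding {C : Type} (n : ℕ) (P' : Finset (C → Bool)) (F' : Finset (C → Option C))
    (hP : P'.Nonempty) : RankedAlphabet where
  carrier := Σ k : Fin (n + 1), P' × (Fin k → F')
  rk d := d.1
  finite := inferInstance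
  exists_nullary := hP.elim fun p hp => ⟨⟨0, ⟨p, hp⟩, fun i => i.elim0⟩, rfl⟩

/-- A tree `b` over the corresponding ranked alphabet is a behaviour starting in `c` if there is a
family of configurations at its positions such that every predicate holds and every instruction is
defined and leads to the configuration at the successor. -/
def IsBehaviour {C : Type} {n : ℕ} {P' : Finset (C → Bool)} {F' : Finset (C → Option C)}
    {hP : P'.Nonempty} (c : C) (b : RTree (corresponding n P' F' hP)) : Prop :=
  ∃ conf : List ℕ → C, conf [] = c ∧
    ∀ w ∈ b.pos, ∀ d, b.labelAt w = some d →
      d.2.1.val (conf w) = true ∧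
      ∀ i : Fin d.1, (d.2.2 i).val (conf w) = some (conf (w ++ [i.val + 1]))

/-- The extension `⟨D, A⟩`: its symbols are the pairs `⟨d, *⟩` with `d` of rank 1, and the pairs
`⟨d, a⟩` of symbols of the same rank. -/
abbrev extension (D A : RankedAlphabet) : RankedAlphabet where
  carrier := {d : D.carrier // D.rk d = 1} ⊕ {q : D.carrier × A.carrier // D.rk q.1 = A.rk q.2}
  rk := Sum.elim (fun _ => 1) fun q => A.rk q.val.2
  finite := inferInstance
  exists_nullary :=
    D.exists_nullary.elim fun d hd => A.exists_nullary.elim fun a ha =>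
      ⟨Sum.inr ⟨(d, a), hd.trans ha.symm⟩, ha⟩

/-- The first projection `pr₁` from symbols of `⟨D, A⟩` to symbols of `D`. -/
def extensionFst (D A : RankedAlphabet) : (extension D A).carrier → D.carrier :=
  Sum.elim (fun d => d.val) fun q => q.val.1

theorem rk_extensionFst (D A : RankedAlphabet) (x : (extension D A).carrier) :
    D.rk (extensionFst D A x) = (extension D A).rk x := by
  rcases x with ⟨d, h⟩ | ⟨q, h⟩
  · exact h
  · exact h

/-- The rewrite relation of the term rewriting system with the rules
`a(x₁,…,x_k) → ⟨d, *⟩(a(x₁,…,x_k))` for `d` of rank 1, and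
`a(x₁,…,x_k) → ⟨d, a⟩(x₁,…,x_k)` for `d` of rank `k`, applied at any position. -/
inductive Rewrite (D A : RankedAlphabet) :
    RTree (A.sum (extension D A)) → RTree (A.sum (extension D A)) → Prop
  | chain (a : A.carrier) (c : Fin (A.rk a) → RTree (A.sum (extension D A)))
      (d : D.carrier) (hd : D.rk d = 1) :
      Rewrite D A (RTree.node (A := A.sum (extension D A)) (Sum.inl a) c)
        (RTree.node (A := A.sum (extension D A)) (Sum.inr (Sum.inl ⟨d, hd⟩))
          fun _ => RTree.node (A := A.sum (extension D A)) (Sum.inl a) c)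
  | label (a : A.carrier) (c : Fin (A.rk a) → RTree (A.sum (extension D A)))
      (d : D.carrier) (hd : D.rk d = A.rk a) :
      Rewrite D A (RTree.node (A := A.sum (extension D A)) (Sum.inl a) c)
        (RTree.node (A := A.sum (extension D A)) (Sum.inr (Sum.inr ⟨(d, a), hd⟩)) c)
  | child (b : (A.sum (extension D A)).carrier)
      (c : Fin ((A.sum (extension D A)).rk b) → RTree (A.sum (extension D A)))
      (i : Fin ((A.sum (extension D A)).rk b)) (t : RTree (A.sum (extension D A))) :
      Rewrite D A (c i) t → Rewrite D A (RTree.node b c) (RTree.node b (Function.update c i t))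

/-- The set of behaviours on the tree `ξ`: the trees `ζ` over `⟨Δ, A⟩` to which `ξ` can be
rewritten and whose first projection is a behaviour starting in `c₀`. -/
def behavioursOn {C : Type} {n : ℕ} {P' : Finset (C → Bool)} {F' : Finset (C → Option C)}
    {hP : P'.Nonempty} (c₀ : C) {A : RankedAlphabet} (ξ : RTree A) :
    Set (RTree (extension (corresponding n P' F' hP) A)) :=
  {ζ | Relation.ReflTransGen (Rewrite (corresponding n P' F' hP) A)
        (ξ.map Sum.inl fun _ => rfl) (ζ.map Sum.inr fun _ => rfl) ∧
      IsBehaviour c₀ (ζ.map (extensionFst _ A) (rk_extensionFst _ A))}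

/-- The composition of a tree transformation and a weighted tree language. -/
def compose {A B : RankedAlphabet} {K : Type u} [CompleteAddMonoid K] (τ : RTree A → Set (RTree B))
    (s : RTree B → K) (ξ : RTree A) : K :=
  csum fun ζ : {ζ : RTree B // ζ ∈ τ ξ} => s ζ

/-- `s` is `(S, A, K)`-definable: there are non-empty finite sets `P' ⊆ P` and `F' ⊆ F` such that,
for the ranked alphabet `Δ` corresponding to `A`, `P'`, `F'`, there is a sentence `e` in
`MExp(⟨Δ, A⟩, K)` such that `s` is the composition of the mapping that yields the `Δ`-behaviours
on a tree, and the semantics of `e`. -/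
def Definable (S : StorageType) {A : RankedAlphabet} {K : Type u} [CompleteMMonoid K]
    (s : RTree A → K) : Prop :=
  ∃ (P' : Finset (S.C → Bool)) (F' : Finset (S.C → Option S.C)) (hP : P'.Nonempty),
    F'.Nonempty ∧ (P' : Set (S.C → Bool)) ⊆ S.P ∧ (F' : Set (S.C → Option S.C)) ⊆ S.F ∧
    ∃ e : MExp (extension (corresponding A.maxrk P' F' hP) A) K, e.IsSentence ∧
      compose (behavioursOn S.c₀) e.sem = s

end WTL

/-!
For the trivial storage type the alphabet `Δ` has exactly one symbol of each possible rank, and every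
tree over it is a behaviour. Hence the behaviours on `ξ` are exactly the trees `ζ` over `⟨Δ, A⟩`
that become `ξ` when the symbols `⟨d, *⟩` are deleted (`mem_behavioursOn_TRIV`): deleting these symbols is
invariant under rewriting, and conversely every such `ζ` can be produced. Thus `ζ` differs from `ξ`
by chains of symbols `⟨d, *⟩` above its nodes.

*From M-expressions to definability.* A formula over `A` is translated symbol by symbol, and an
expression `H(ω)` is given the constant zero operation at the symbols `⟨d, *⟩`. By absorptivity the
translated expression vanishes on trees with chains, so only the unique chain-free tree above `ξ`
contributes to the sum, and it contributes the original value (`MExp.definable_TRIV`).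

*From definability to M-expressions.* If `K` is compressible, then all operations in `Ω` commute
with countable sums, and weighted tree automata over `K` can be evaluated bottom-up, state by state.
The argument passes through automata.

* MSO-formulas describe recognizable languages of trees whose nodes are marked by variables
  (`MSO.recognizes`). Set quantifiers are handled by the subset construction, and a first-order
  variable is a set variable with exactly one element.
* M-expressions define series that are recognizable by weighted tree automata (`MExp.recognizes`):
  a guard is a product with a deterministic automaton, and a sum over a variable is an automaton that
  guesses the marks of the variable.
* The sum of a recognizable series over all chains is recognizable (`WTA.val_compress`). The weights
  of all chains between two states form a countable sum of unary operations in `Ω`, which is again in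
  `Ω`, and it is composed with the operation at the node below the chain. Only unary operations may
  be added, so a transition of the new automaton also records where the chain starts.
* Recognizable series are defined by sentences (`RecognizableSeries.exists_sentence`): with one set
  variable per transition, sum over all assignments, and let a guard check that the marks form a run.
  Nodes that are not marked by exactly one transition get the zero operation, so absorptivity deletes
  the corresponding summands. That the remaining sum is the value of the automaton is seen by
  dropping the check of one variable at a time (`WTA.val_checked_guess`).
-/

namespace WTL

open CompleteAddMonoid (csum)
open CompleteMMonoid (Ops)

/-! ### Countable sums -/

section Csum

variable {K : Type u} [CompleteAddMonoid K]

theorem csum_unique {I : Type} [Unique I] (f : I → K) : csum f = f default := by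
  rw [CompleteAddMonoid.csum_of_fintype, Fintype.sum_unique]

theorem csum_equiv {I J : Type} [Countable I] [Countable J] (e : I ≃ J) (f : J → K) :
    (csum fun i => f (e i)) = csum f := by
  rw [CompleteAddMonoid.csum_partition e]
  congr 1
  funext j
  let _ : Unique {i : I // e i = j} :=
    { default := ⟨e.symm j, e.apply_symm_apply j⟩
      uniq := fun i => Subtype.ext ((e.symm_apply_eq.2 i.2.symm).symm) }
  rw [csum_unique, (default : {i : I // e i = j}).2]

theorem csum_prod {I J : Type} [Countable I] [Countable J] (f : I × J → K) :
    csum f = csum fun i => csum fun j => f (i, j) := by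
  rw [CompleteAddMonoid.csum_partition Prod.fst]
  congr 1
  funext i
  let e : J ≃ {p : I × J // p.1 = i} :=
    { toFun := fun j => ⟨(i, j), rfl⟩
      invFun := fun p => p.1.2
      left_inv := fun _ => rfl
      right_inv := fun p => Subtype.ext (Prod.ext p.2.symm rfl) }
  exact (csum_equiv e fun p => f p.1).symm

theorem csum_comm {I J : Type} [Countable I] [Countable J] (f : I → J → K) :
    (csum fun i => csum fun j => f i j) = csum fun j => csum fun i => f i j := by
  rw [← csum_prod fun p : I × J => f p.1 p.2, ← csum_prod fun p : J × I => f p.2 p.1]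
  exact csum_equiv (Equiv.prodComm I J) fun p : J × I => f p.2 p.1

theorem csum_finset_sum {I J : Type} [Countable I] [Fintype J] (f : I → J → K) :
    (csum fun i => ∑ j, f i j) = ∑ j, csum fun i => f i j := by
  simp only [← CompleteAddMonoid.csum_of_fintype]
  exact csum_comm f

theorem csum_empty {I : Type} [IsEmpty I] (f : I → K) : csum f = 0 := by
  let _ : Fintype I := Fintype.ofIsEmpty
  rw [CompleteAddMonoid.csum_of_fintype, Finset.univ_eq_empty, Finset.sum_empty]

/-- The constant zero family has sum zero, because the empty family can be partitioned into
arbitrarily many empty blocks. -/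
theorem csum_zero {I : Type} [Countable I] : (csum fun _ : I => (0 : K)) = 0 := by
  have h := CompleteAddMonoid.csum_partition (fun e : Empty => (e.elim : I)) fun _ => (0 : K)
  have h' : ∀ i : I, (csum fun _ : {e : Empty // (e.elim : I) = i} => (0 : K)) = 0 := fun i => by
    have : IsEmpty {e : Empty // (e.elim : I) = i} := ⟨fun e => e.1.elim⟩
    exact csum_empty _
  simp only [h'] at h
  rw [← h, csum_empty]

theorem csum_eq_single {I : Type} [Countable I] (f : I → K) (i₀ : I)
    (h : ∀ i, i ≠ i₀ → f i = 0) : csum f = f i₀ := by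
  classical
  rw [CompleteAddMonoid.csum_partition (fun i => decide (i = i₀)),
    CompleteAddMonoid.csum_of_fintype, Fintype.sum_bool]
  let _ : Unique {i : I // decide (i = i₀) = true} :=
    { default := ⟨i₀, by simp⟩
      uniq := fun i => Subtype.ext (by simpa using i.2) }
  have h₂ : (fun i : {i : I // decide (i = i₀) = false} => f i) = fun _ => 0 := by
    funext i
    exact h _ (by simpa using i.2)
  rw [csum_unique, h₂, csum_zero, add_zero]
  rfl

end Csum

section Distributive

variable {K : Type u} [CompleteMMonoid K]

/-- Operations of a compressible `K` commute with countable sums; for constants this is trivial. -/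
theorem Compressible.completelyDistributive (hK : Compressible K) {k : ℕ} {ω : Op K k}
    (hω : ω ∈ Ops (K := K) k) : CompletelyDistributive ω := by
  rcases k.eq_zero_or_pos with rfl | hk
  · intro I _ a
    rw [csum_unique]
    congr 1
    funext j
    exact j.elim0
  · exact hK.distributive k hk ω hω

theorem Compressible.map_sum_piFinset (hK : Compressible K) {k : ℕ} {ω : Op K k}
    (hω : ω ∈ Ops (K := K) k) {ι : Type} [DecidableEq ι] (s : Fin k → Finset ι)
    (a : Fin k → ι → K) :
    ω (fun i => ∑ j ∈ s i, a i j) = ∑ j ∈ Fintype.piFinset s, ω fun i => a i (j i) := by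
  have h := hK.completelyDistributive hω (fun i => s i) fun i j => a i j
  simp only [CompleteAddMonoid.csum_of_fintype] at h
  have h₁ : ∀ i, ∑ j : s i, a i j = ∑ j ∈ s i, a i j := fun i =>
    Finset.sum_coe_sort (s i) (a i)
  simp only [h₁] at h
  rw [h]
  refine Finset.sum_bij (fun j _ i => (j i : ι)) ?_ ?_ ?_ ?_
  · intro j _
    simp
  · intro j _ j' _ hj
    funext i
    exact Subtype.ext (congrFun hj i)
  · intro j hj
    rw [Fintype.mem_piFinset] at hj
    exact ⟨fun i => ⟨j i, hj i⟩, Finset.mem_univ _, rfl⟩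
  · intro j _
    rfl

theorem Compressible.map_csum_one (hK : Compressible K) {ω : Op K 1}
    (hω : ω ∈ Ops (K := K) 1) {I : Type} [Countable I] (a : I → K) :
    (ω fun _ => csum a) = csum fun i => ω fun _ => a i := by
  rw [hK.completelyDistributive hω (fun _ => I) fun _ => a,
    ← csum_equiv (Equiv.funUnique (Fin 1) I) fun i => ω fun _ => a i]
  congr 1
  funext i
  congr 1
  funext j
  rw [Subsingleton.elim j 0]
  rfl

theorem Compressible.map_sum_one (hK : Compressible K) {ω : Op K 1}
    (hω : ω ∈ Ops (K := K) 1) {I : Type} [Fintype I] (a : I → K) :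
    (ω fun _ => ∑ i, a i) = ∑ i, ω fun _ => a i := by
  simp only [← CompleteAddMonoid.csum_of_fintype]
  exact hK.map_csum_one hω a

theorem apply_zero_of_mem_Ops {k : ℕ} {ω : Op K k} (hω : ω ∈ Ops (K := K) k) {a : Fin k → K}
    (i : Fin k) (h : a i = 0) : ω a = 0 :=
  CompleteMMonoid.absorptive k ω hω a i h

end Distributive

/-! ### Marked trees -/

namespace RTree

variable {A : RankedAlphabet}

theorem nil_mem_pos (ξ : RTree A) : [] ∈ ξ.pos := by
  cases ξ
  simp [pos]

theorem mem_pos_node {a : A.carrier} {c : Fin (A.rk a) → RTree A} {w : List ℕ} :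
    w ∈ (node a c).pos ↔ w = [] ∨ ∃ i, ∃ u ∈ (c i).pos, w = (i.val + 1) :: u := by
  simp only [pos, Finset.mem_insert, Finset.mem_biUnion, Finset.mem_univ, true_and,
    Finset.mem_image, eq_comm]

theorem cons_mem_pos_node {a : A.carrier} {c : Fin (A.rk a) → RTree A} {i : Fin (A.rk a)}
    {u : List ℕ} : (i.val + 1) :: u ∈ (node a c).pos ↔ u ∈ (c i).pos := by
  rw [mem_pos_node]
  constructor
  · rintro (h | ⟨j, u', hu', h⟩)
    · cases h
    · rw [List.cons.injEq, Nat.add_right_cancel_iff] at h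
      obtain ⟨h, rfl⟩ := h
      rwa [Fin.ext h]
  · exact fun h => Or.inr ⟨i, u, h, rfl⟩

/-- The set of positions that is composed of sets of positions of the direct subtrees, and of the
root if `b` is true. -/
def joinPos {k : ℕ} (b : Bool) (W : Fin k → Finset (List ℕ)) : Finset (List ℕ) :=
  (if b then {[]} else ∅) ∪ Finset.univ.biUnion fun i => (W i).image (List.cons (i.val + 1))

theorem nil_mem_joinPos {k : ℕ} {b : Bool} {W : Fin k → Finset (List ℕ)} :
    [] ∈ joinPos b W ↔ b = true := by
  cases b <;> simp [joinPos]

theorem cons_mem_joinPos {k : ℕ} {b : Bool} {W : Fin k → Finset (List ℕ)} {i : Fin k}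
    {u : List ℕ} : (i.val + 1) :: u ∈ joinPos b W ↔ u ∈ W i := by
  have h : (i.val + 1) :: u ∈ joinPos b W ↔ ∃ j : Fin k, u ∈ W j ∧ j.val = i.val := by
    cases b <;> simp [joinPos]
  rw [h]
  exact ⟨fun ⟨j, hj, hji⟩ => Fin.ext hji ▸ hj, fun h => ⟨i, h, rfl⟩⟩

theorem joinPos_subset {a : A.carrier} {c : Fin (A.rk a) → RTree A} {b : Bool}
    {W : Fin (A.rk a) → Finset (List ℕ)} (hW : ∀ i, W i ⊆ (c i).pos) :
    joinPos b W ⊆ (node a c).pos := by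
  intro w hw
  rw [mem_pos_node]
  rw [joinPos, Finset.mem_union, Finset.mem_biUnion] at hw
  rcases hw with hw | ⟨i, _, hw⟩
  · cases b
    · simp at hw
    · exact Or.inl (by simpa using hw)
  · rw [Finset.mem_image] at hw
    obtain ⟨u, hu, rfl⟩ := hw
    exact Or.inr ⟨i, u, hW i hu, rfl⟩

/-- The part of a set of positions that lies in the `i`-th direct subtree. -/
def subPos {k : ℕ} (c : Fin k → RTree A) (W : Finset (List ℕ)) (i : Fin k) : Finset (List ℕ) :=
  (c i).pos.filter fun u => (i.val + 1) :: u ∈ W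

theorem joinPos_subPos {a : A.carrier} {c : Fin (A.rk a) → RTree A} {W : Finset (List ℕ)}
    (hW : W ⊆ (node a c).pos) : joinPos (decide ([] ∈ W)) (subPos c W) = W := by
  apply Finset.Subset.antisymm
  · intro w hw
    rcases mem_pos_node.1 (joinPos_subset (fun i => Finset.filter_subset _ _) hw) with
      rfl | ⟨i, u, hu, rfl⟩
    · exact of_decide_eq_true (nil_mem_joinPos.1 hw)
    · exact (Finset.mem_filter.1 (cons_mem_joinPos.1 hw)).2
  · intro w hw
    rcases mem_pos_node.1 (hW hw) with rfl | ⟨i, u, hu, rfl⟩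
    · exact nil_mem_joinPos.2 (decide_eq_true hw)
    · exact cons_mem_joinPos.2 (Finset.mem_filter.2 ⟨hu, hw⟩)

theorem subPos_joinPos {k : ℕ} {c : Fin k → RTree A} {b : Bool}
    {W : Fin k → Finset (List ℕ)} (hW : ∀ i, W i ⊆ (c i).pos) :
    subPos c (joinPos b W) = W := by
  funext i
  ext u
  rw [subPos, Finset.mem_filter, cons_mem_joinPos]
  exact ⟨fun h => h.2, fun h => ⟨hW i h, h⟩⟩

theorem sum_powerset_pos_node {K : Type u} [AddCommMonoid K] {a : A.carrier}
    {c : Fin (A.rk a) → RTree A} (f : Finset (List ℕ) → K) :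
    ∑ W ∈ (node a c).pos.powerset, f W =
      ∑ b : Bool, ∑ W ∈ Fintype.piFinset fun i => (c i).pos.powerset, f (joinPos b W) := by
  rw [← Finset.sum_product']
  refine Finset.sum_nbij' (fun W => (decide ([] ∈ W), subPos c W))
    (fun p => joinPos p.1 p.2) ?_ ?_ ?_ ?_ ?_
  · intro W _
    simp only [Finset.mem_product, Finset.mem_univ, true_and, Fintype.mem_piFinset,
      Finset.mem_powerset]
    exact fun i => Finset.filter_subset _ _
  · rintro ⟨b, W⟩ h
    simp only [Finset.mem_product, Finset.mem_univ, true_and, Fintype.mem_piFinset,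
      Finset.mem_powerset] at h
    exact Finset.mem_powerset.2 (joinPos_subset h)
  · intro W hW
    exact joinPos_subPos (Finset.mem_powerset.1 hW)
  · rintro ⟨b, W⟩ h
    simp only [Finset.mem_product, Finset.mem_univ, true_and, Fintype.mem_piFinset,
      Finset.mem_powerset] at h
    refine Prod.ext ?_ (subPos_joinPos h)
    cases b <;> simp [nil_mem_joinPos]
  · intro W hW
    rw [joinPos_subPos (Finset.mem_powerset.1 hW)]

theorem card_joinPos {k : ℕ} (b : Bool) (W : Fin k → Finset (List ℕ)) :
    (joinPos b W).card = (if b then 1 else 0) + ∑ i, (W i).card := by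
  rw [joinPos, Finset.card_union_of_disjoint, Finset.card_biUnion]
  · congr 1
    · cases b <;> simp
    · refine Finset.sum_congr rfl fun i _ => ?_
      exact Finset.card_image_of_injective _ fun u v h => (List.cons.inj h).2
  · intro i _ j _ hij
    refine Finset.disjoint_left.2 ?_
    intro w hi hj
    simp only [Finset.mem_image] at hi hj
    obtain ⟨u, _, rfl⟩ := hi
    obtain ⟨v, _, h⟩ := hj
    rw [List.cons.injEq, Nat.add_right_cancel_iff] at h
    exact hij (Fin.ext h.1.symm)
  · rw [Finset.disjoint_left]
    intro w hw
    cases b <;> simp_all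

variable {U : Finset Var}

/-- The set of variables that results from `V` when `v` is put in or taken out according to `b`. -/
def setMark (v : Var) (b : Prop) (V : Set U) : Set U :=
  {u | (u.1 = v ∧ b) ∨ (u.1 ≠ v ∧ u ∈ V)}

/-- The tree that results when the marks for the variable `v` are replaced: the new marks are at the
positions in `p`. -/
def mark (v : Var) : (p : List ℕ → Prop) → RTree (A.ext U) → RTree (A.ext U)
  | p, node a c => node (A := A.ext U) (a.1, setMark v (p []) a.2)
      fun i => mark v (fun u => p ((i.val + 1) :: u)) (c i)

theorem pos_encode (ρ : Assignment) (ξ : RTree A) :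
    ∀ w, (encode U ρ w ξ).pos = ξ.pos := by
  induction ξ with
  | node a c ih =>
    intro w
    simp only [encode, pos, ih]

/-- If two assignments differ at most at `v`, their encodings differ in the marks for `v` only. -/
theorem mark_encode {ρ ρ' : Assignment} {v : Var}
    (h : ∀ w, ∀ u ∈ U, u ≠ v → (ρ.Marks w u ↔ ρ'.Marks w u)) (ξ : RTree A) :
    ∀ w, mark v (fun u => ρ'.Marks (w ++ u) v) (encode U ρ w ξ) = encode U ρ' w ξ := by
  induction ξ with
  | node a c ih =>
    intro w
    have hs : setMark v (ρ'.Marks (w ++ []) v) {u : U | ρ.Marks w u} =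
        {u : U | ρ'.Marks w u} := by
      ext ⟨u, hu⟩
      by_cases huv : u = v
      · subst huv
        simp [setMark]
      · simp [setMark, huv, h w u hu huv]
    have hc : ∀ i : Fin (A.rk a),
        mark v (fun u => ρ'.Marks (w ++ (i.val + 1) :: u) v) (encode U ρ (w ++ [i.val + 1]) (c i))
          = encode U ρ' (w ++ [i.val + 1]) (c i) := fun i => by
      rw [← ih i]
      simp
    simp only [encode, mark]
    rw [hs]
    simp only [hc]

theorem mark_encode_updSO (ρ : Assignment) (X : ℕ) (W : Finset (List ℕ)) (ξ : RTree A) :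
    mark (Sum.inr X) (fun u => u ∈ W) (encode U ρ [] ξ) = encode U (ρ.updSO X W) [] ξ := by
  rw [← mark_encode (ρ := ρ) (ρ' := ρ.updSO X W) (v := Sum.inr X) ?_ ξ []]
  · simp [Assignment.Marks, Assignment.updSO]
  · rintro w (x | Y) _ h
    · exact Iff.rfl
    · have : Y ≠ X := fun e => h (by rw [e])
      simp [Assignment.Marks, Assignment.updSO, this]

theorem mark_encode_updFO (ρ : Assignment) (x : ℕ) (w : List ℕ) (ξ : RTree A) :
    mark (Sum.inl x) (fun u => u ∈ ({w} : Finset (List ℕ))) (encode U ρ [] ξ) =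
      encode U (ρ.updFO x w) [] ξ := by
  rw [← mark_encode (ρ := ρ) (ρ' := ρ.updFO x w) (v := Sum.inl x) ?_ ξ []]
  · simp [Assignment.Marks, Assignment.updFO, eq_comm]
  · rintro w (y | Y) _ h
    · have : y ≠ x := fun e => h (by rw [e])
      simp [Assignment.Marks, Assignment.updFO, this]
    · exact Iff.rfl

theorem mark_joinPos (v : Var) {a : (A.ext U).carrier}
    {c : Fin ((A.ext U).rk a) → RTree (A.ext U)} (b : Bool)
    (W : Fin ((A.ext U).rk a) → Finset (List ℕ)) :
    mark v (fun u => u ∈ joinPos b W) (node a c) =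
      node (A := A.ext U) (a.1, setMark v (b = true) a.2)
        fun i => mark v (fun u => u ∈ W i) (c i) := by
  have h : ∀ i : Fin (A.rk a.1), ∀ u, (i.val + 1) :: u ∈ joinPos b W ↔ u ∈ W i := fun i u =>
    cons_mem_joinPos
  rw [mark, propext (nil_mem_joinPos (b := b) (W := W))]
  simp only [h]

/-- The number of positions that are marked by `v`. -/
noncomputable def countMarks (v : U) : RTree (A.ext U) → ℕ :=
  open Classical in hom fun a n => (if v ∈ a.2 then 1 else 0) + ∑ i, n i

theorem countMarks_mark (v : U) (t : RTree (A.ext U)) :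
    ∀ W ⊆ t.pos, countMarks v (mark v (fun u => u ∈ W) t) = W.card := by
  classical
  induction t with
  | node a c ih =>
    intro W hW
    rw [← joinPos_subPos hW, mark_joinPos, card_joinPos]
    have hv : v ∈ setMark v.1 (decide ([] ∈ W) = true) a.2 ↔ decide ([] ∈ W) = true := by
      simp [setMark]
    rw [countMarks, hom]
    simp only [hv]
    congr 1
    refine Finset.sum_congr rfl fun i _ => ?_
    exact ih i _ (Finset.filter_subset _ _)

end RTree

/-! ### Recognizable tree languages -/

/-- A tree language is recognizable if it is the inverse image of a set under the homomorphism
into a finite algebra, i.e., the language of a deterministic bottom-up tree automaton. -/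
def Recognizable {D : RankedAlphabet} (L : RTree D → Prop) : Prop :=
  ∃ (R : Type) (_ : Finite R) (δ : (a : D.carrier) → Op R (D.rk a)) (F : Set R),
    ∀ t, L t ↔ t.hom δ ∈ F

namespace Recognizable

variable {D : RankedAlphabet} {L L' : RTree D → Prop}

theorem not (h : Recognizable L) : Recognizable fun t => ¬ L t := by
  obtain ⟨R, hR, δ, F, h⟩ := h
  exact ⟨R, hR, δ, Fᶜ, fun t => not_congr (h t)⟩

theorem and (h : Recognizable L) (h' : Recognizable L') : Recognizable fun t => L t ∧ L' t := by
  obtain ⟨R, hR, δ, F, h⟩ := h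
  obtain ⟨R', hR', δ', F', h'⟩ := h'
  let ε : (a : D.carrier) → Op (R × R') (D.rk a) := fun a r =>
    (δ a fun i => (r i).1, δ' a fun i => (r i).2)
  have key : ∀ t : RTree D, t.hom ε = (t.hom δ, t.hom δ') := by
    intro t
    induction t with
    | node a c ih => simp only [RTree.hom, ih, ε]
  refine ⟨R × R', inferInstance, ε, F ×ˢ F', fun t => ?_⟩
  rw [key]
  exact and_congr (h t) (h' t)

theorem or (h : Recognizable L) (h' : Recognizable L') : Recognizable fun t => L t ∨ L' t := by
  have := (h.not.and h'.not).not
  simpa only [not_and_or, not_not] using this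

end Recognizable

variable {A : RankedAlphabet} {U : Finset Var}

/-- Quantification over the marks for one variable preserves recognizability, by the subset
construction. -/
theorem Recognizable.exists_mark {L : RTree (A.ext U) → Prop} (h : Recognizable L) (v : Var) :
    Recognizable fun t => ∃ W ⊆ t.pos, L (t.mark v fun u => u ∈ W) := by
  obtain ⟨R, hR, δ, F, h⟩ := h
  let δ' : (a : (A.ext U).carrier) → Op (Set R) ((A.ext U).rk a) := fun a Rs =>
    {r | ∃ b : Bool, ∃ rs, (∀ i, rs i ∈ Rs i) ∧ δ (a.1, RTree.setMark v (b = true) a.2) rs = r}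
  have key : ∀ t : RTree (A.ext U), ∀ r,
      r ∈ t.hom δ' ↔ ∃ W ⊆ t.pos, (t.mark v fun u => u ∈ W).hom δ = r := by
    intro t
    induction t with
    | node a c ih =>
      intro r
      constructor
      · rintro ⟨b, rs, hrs, rfl⟩
        choose W hW hW' using fun i => (ih i (rs i)).1 (hrs i)
        refine ⟨RTree.joinPos b W, RTree.joinPos_subset hW, ?_⟩
        rw [RTree.mark_joinPos, RTree.hom]
        simp only [hW']
      · rintro ⟨W, hW, rfl⟩
        rw [← RTree.joinPos_subPos hW, RTree.mark_joinPos]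
        exact ⟨_, _, fun i => (ih i _).2 ⟨_, Finset.filter_subset _ _, rfl⟩, rfl⟩
  refine ⟨Set R, inferInstance, δ', {Rs | ∃ r ∈ Rs, r ∈ F}, fun t => ?_⟩
  simp only [Set.mem_ofPred_eq, key, h]
  constructor
  · rintro ⟨W, hW, hF⟩
    exact ⟨_, ⟨W, hW, rfl⟩, hF⟩
  · rintro ⟨_, ⟨W, hW, rfl⟩, hF⟩
    exact ⟨W, hW, hF⟩

/-- It suffices to count up to two. -/
theorem recognizable_countMarks_eq_one (v : U) :
    Recognizable fun t : RTree (A.ext U) => t.countMarks v = 1 := by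
  classical
  let δ : (a : (A.ext U).carrier) → Op (Fin 3) ((A.ext U).rk a) := fun a n =>
    ⟨min 2 ((if v ∈ a.2 then 1 else 0) + ∑ i, (n i).val), by omega⟩
  have hmin : ∀ {k : ℕ} (m : ℕ) (n : Fin k → ℕ),
      min 2 (m + ∑ i, min 2 (n i)) = min 2 (m + ∑ i, n i) := by
    intro k
    induction k with
    | zero => simp
    | succ k ih =>
      intro m n
      rw [Fin.sum_univ_succ, Fin.sum_univ_succ, ← add_assoc, ← add_assoc, ih]
      omega
  have key : ∀ t : RTree (A.ext U), (t.hom δ).val = min 2 (t.countMarks v) := by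
    intro t
    induction t with
    | node a c ih =>
      rw [RTree.countMarks, RTree.hom, RTree.hom]
      simp only [δ, ih]
      exact hmin _ _
  refine ⟨Fin 3, inferInstance, δ, {1}, fun t => ?_⟩
  rw [Set.mem_singleton_iff, ← Fin.val_inj, key]
  change _ ↔ _ = 1
  omega

/-- Existence of a node whose label has a given property. -/
theorem recognizable_exists_node (p : A.carrier × Set U → Prop) :
    ∃ L : RTree (A.ext U) → Prop, Recognizable L ∧ ∀ (ξ : RTree A) (ρ : Assignment),
      L (RTree.encode U ρ [] ξ) ↔
        ∃ w a, ξ.labelAt w = some a ∧ p (a, {v : U | ρ.Marks w v}) := by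
  let δ : (a : (A.ext U).carrier) → Op Prop ((A.ext U).rk a) := fun a q => p a ∨ ∃ i, q i
  refine ⟨fun t => t.hom δ, ⟨Prop, inferInstance, δ, {q | q}, fun t => Iff.rfl⟩, ?_⟩
  intro ξ ρ
  have key : ∀ w₀, (RTree.encode U ρ w₀ ξ).hom δ ↔
      ∃ w a, ξ.labelAt w = some a ∧ p (a, {v : U | ρ.Marks (w₀ ++ w) v}) := by
    induction ξ with
    | node a c ih =>
      intro w₀
      have h : (RTree.encode U ρ w₀ (RTree.node a c)).hom δ ↔
          p (a, {v : U | ρ.Marks w₀ v}) ∨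
            ∃ i : Fin (A.rk a), (RTree.encode U ρ (w₀ ++ [i.val + 1]) (c i)).hom δ := Iff.rfl
      rw [h]
      constructor
      · rintro (h | ⟨i, h⟩)
        · exact ⟨[], a, rfl, by simpa using h⟩
        · obtain ⟨w, b, hb, h⟩ := (ih i _).1 h
          refine ⟨(i.val + 1) :: w, b, ?_, by simpa using h⟩
          simpa [RTree.labelAt] using hb
      · rintro ⟨w, b, hb, h⟩
        match w, hb with
        | [], hb =>
          rw [RTree.labelAt, Option.some.injEq] at hb
          subst hb
          exact Or.inl (by simpa using h)
        | (n + 1) :: w, hb =>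
          rw [RTree.labelAt] at hb
          split_ifs at hb with hn
          exact Or.inr ⟨⟨n, hn⟩, (ih _ _).2 ⟨w, b, hb, by simpa using h⟩⟩
  exact key []

/-- Existence of a node with mark `x` whose `i`-th successor exists and has mark `y`. -/
theorem recognizable_edge (i : ℕ) (x y : ℕ) (hx : Sum.inl x ∈ U) (hy : Sum.inl y ∈ U) :
    ∃ L : RTree (A.ext U) → Prop, Recognizable L ∧ ∀ (ξ : RTree A) (ρ : Assignment),
      L (RTree.encode U ρ [] ξ) ↔
        ρ.fo x ∈ ξ.pos ∧ ρ.fo y ∈ ξ.pos ∧ ρ.fo y = ρ.fo x ++ [i + 1] := by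
  -- The first component of a state tells whether the root is marked by `y`.
  let δ : (a : (A.ext U).carrier) → Op (Prop × Prop) ((A.ext U).rk a) := fun a q =>
    ((⟨_, hy⟩ : U) ∈ a.2,
      (∃ j, (q j).2) ∨ ((⟨_, hx⟩ : U) ∈ a.2 ∧ ∃ h : i < (A.ext U).rk a, (q ⟨i, h⟩).1))
  refine ⟨fun t => (t.hom δ).2, ⟨Prop × Prop, inferInstance, δ, {q | q.2}, fun t => Iff.rfl⟩, ?_⟩
  intro ξ ρ
  have key₁ : ∀ (ξ : RTree A) w, ((RTree.encode U ρ w ξ).hom δ).1 ↔ ρ.fo y = w := by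
    rintro ⟨a, c⟩ w
    exact Iff.rfl
  have key : ∀ w, ((RTree.encode U ρ w ξ).hom δ).2 ↔
      ∃ u ∈ ξ.pos, ρ.fo x = w ++ u ∧ u ++ [i + 1] ∈ ξ.pos ∧ ρ.fo y = w ++ u ++ [i + 1] := by
    induction ξ with
    | node a c ih =>
      intro w
      have h : ((RTree.encode U ρ w (RTree.node a c)).hom δ).2 ↔
          (∃ j : Fin (A.rk a), ((RTree.encode U ρ (w ++ [j.val + 1]) (c j)).hom δ).2) ∨
            (ρ.fo x = w ∧ ∃ h : i < A.rk a,
              ((RTree.encode U ρ (w ++ [i + 1]) (c ⟨i, h⟩)).hom δ).1) := Iff.rfl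
      rw [h]
      simp only [key₁, ih]
      constructor
      · rintro (⟨j, u, hu, hxu, hu', hyu⟩ | ⟨hxw, hi, hyw⟩)
        · exact ⟨(j.val + 1) :: u, RTree.cons_mem_pos_node.2 hu, by simpa using hxu,
            RTree.cons_mem_pos_node.2 hu', by simpa using hyu⟩
        · exact ⟨[], RTree.nil_mem_pos _, by simpa using hxw,
            (RTree.cons_mem_pos_node (i := ⟨i, hi⟩)).2 (RTree.nil_mem_pos _), by simpa using hyw⟩
      · rintro ⟨u, hu, hxu, hu', hyu⟩
        rcases RTree.mem_pos_node.1 hu with rfl | ⟨j, u, hu, rfl⟩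
        · rcases RTree.mem_pos_node.1 hu' with h | ⟨j, u, hu, h⟩
          · cases h
          · rw [List.nil_append, List.cons.injEq, Nat.add_right_cancel_iff] at h
            exact Or.inr ⟨by simpa using hxu, h.1 ▸ j.2, by simpa using hyu⟩
        · exact Or.inl ⟨j, u, RTree.cons_mem_pos_node.1 hu, by simpa using hxu, RTree.cons_mem_pos_node.1 hu',
            by simpa using hyu⟩
  refine (key []).trans ?_
  constructor
  · rintro ⟨u, hu, hxu, hu', hyu⟩
    simp only [List.nil_append] at hxu hyu
    exact ⟨hxu ▸ hu, hyu ▸ hu', by rw [hyu, hxu]⟩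
  · rintro ⟨hx, hy, h⟩
    exact ⟨_, hx, rfl, h ▸ hy, h⟩

/-! ### From MSO-formulas to recognizable languages -/

theorem RTree.exists_labelAt (ξ : RTree A) : ∀ w ∈ ξ.pos, ∃ a, ξ.labelAt w = some a := by
  induction ξ with
  | node b c ih =>
    intro w h
    rcases mem_pos_node.1 h with rfl | ⟨i, u, hu, rfl⟩
    · exact ⟨b, rfl⟩
    · obtain ⟨a, ha⟩ := ih i u hu
      exact ⟨a, by simpa [labelAt] using ha⟩

/-- All variables that occur in a formula, free or bound. -/
def MSO.vars : MSO A → Finset Var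
  | label _ x => {Sum.inl x}
  | edge _ x y => {Sum.inl x, Sum.inl y}
  | mem x X => {Sum.inl x, Sum.inr X}
  | not φ => φ.vars
  | or φ ψ => φ.vars ∪ ψ.vars
  | and φ ψ => φ.vars ∪ ψ.vars
  | existsFO x φ => insert (Sum.inl x) φ.vars
  | forallFO x φ => insert (Sum.inl x) φ.vars
  | existsSO X φ => insert (Sum.inr X) φ.vars
  | forallSO X φ => insert (Sum.inr X) φ.vars

/-- The assignment sends the first-order variables in `V` to positions of `ξ`. -/
def Assignment.Valid (ρ : Assignment) (V : Finset Var) (ξ : RTree A) : Prop :=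
  ∀ x, Sum.inl x ∈ V → ρ.fo x ∈ ξ.pos

theorem Assignment.Valid.mono {ρ : Assignment} {V V' : Finset Var} {ξ : RTree A}
    (h : ρ.Valid V' ξ) (hV : V ⊆ V') : ρ.Valid V ξ := fun x hx => h x (hV hx)

theorem Assignment.Valid.updFO {ρ : Assignment} {V : Finset Var} {ξ : RTree A} {x : ℕ}
    (h : ρ.Valid (V.erase (Sum.inl x)) ξ) {w : List ℕ} (hw : w ∈ ξ.pos) :
    (ρ.updFO x w).Valid V ξ := by
  intro y hy
  by_cases hxy : y = x
  · subst hxy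
    simpa [Assignment.updFO] using hw
  · simpa [Assignment.updFO, hxy] using h y (by simp [hxy, hy])

theorem Assignment.Valid.updSO {ρ : Assignment} {V : Finset Var} {ξ : RTree A} {X : ℕ}
    (h : ρ.Valid (V.erase (Sum.inr X)) ξ) (W : Finset (List ℕ)) :
    (ρ.updSO X W).Valid V ξ := fun y hy => h y (by simp [hy])

/-- The property of `ξ` and `ρ` is a recognizable property of the encoding of the pair, provided
that `ρ` is valid for the variables in `V`. -/
def Recognizes (U V : Finset Var) (p : RTree A → Assignment → Prop) : Prop :=
  ∃ L : RTree (A.ext U) → Prop, Recognizable L ∧ ∀ ξ ρ, ρ.Valid V ξ →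
    (p ξ ρ ↔ L (RTree.encode U ρ [] ξ))

theorem Recognizes.not {V : Finset Var} {p : RTree A → Assignment → Prop}
    (h : Recognizes U V p) : Recognizes U V fun ξ ρ => ¬ p ξ ρ := by
  obtain ⟨L, hL, h⟩ := h
  exact ⟨_, hL.not, fun ξ ρ hρ => not_congr (h ξ ρ hρ)⟩

theorem Recognizes.existsSO {V : Finset Var} {X : ℕ}
    {p : RTree A → Assignment → Prop} (h : Recognizes U V p) :
    Recognizes U (V.erase (Sum.inr X)) fun ξ ρ => ∃ W ⊆ ξ.pos, p ξ (ρ.updSO X W) := by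
  obtain ⟨L, hL, h⟩ := h
  refine ⟨_, hL.exists_mark (Sum.inr X), fun ξ ρ hρ => ?_⟩
  simp only [RTree.pos_encode, RTree.mark_encode_updSO]
  exact exists_congr fun W => and_congr_right fun hW => h ξ _ (hρ.updSO W)

theorem Recognizes.existsFO {V : Finset Var} {x : ℕ} (hx : Sum.inl x ∈ U)
    {p : RTree A → Assignment → Prop} (h : Recognizes U V p) :
    Recognizes U (V.erase (Sum.inl x)) fun ξ ρ => ∃ w ∈ ξ.pos, p ξ (ρ.updFO x w) := by
  obtain ⟨L, hL, h⟩ := h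
  refine ⟨_, (hL.and (recognizable_countMarks_eq_one ⟨_, hx⟩)).exists_mark (Sum.inl x),
    fun ξ ρ hρ => ?_⟩
  constructor
  · rintro ⟨w, hw, hp⟩
    have hw' : {w} ⊆ (RTree.encode U ρ [] ξ).pos := by simpa [RTree.pos_encode] using hw
    refine ⟨{w}, hw', ?_, ?_⟩
    · rw [RTree.mark_encode_updFO]
      exact (h ξ _ (hρ.updFO hw)).1 hp
    · rw [RTree.countMarks_mark ⟨_, hx⟩ _ _ hw', Finset.card_singleton]
  · rintro ⟨W, hW, hL, hc⟩
    rw [RTree.countMarks_mark ⟨_, hx⟩ _ _ hW, Finset.card_eq_one] at hc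
    obtain ⟨w, rfl⟩ := hc
    have hw : w ∈ ξ.pos := by simpa [RTree.pos_encode] using hW
    rw [RTree.mark_encode_updFO] at hL
    exact ⟨w, hw, (h ξ _ (hρ.updFO hw)).2 hL⟩

theorem MSO.recognizes (φ : MSO A) (hφ : φ.vars ⊆ U) :
    Recognizes U φ.free fun ξ ρ => φ.Models ξ ρ := by
  induction φ with
  | label a x =>
    have hx : Sum.inl x ∈ U := hφ (by simp [vars])
    obtain ⟨L, hL, h⟩ := recognizable_exists_node (A := A) (U := U)
      fun b => b.1 = a ∧ (⟨_, hx⟩ : U) ∈ b.2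
    refine ⟨L, hL, fun ξ ρ _ => ?_⟩
    rw [h]
    constructor
    · exact fun h => ⟨_, a, h, rfl, rfl⟩
    · rintro ⟨w, b, hb, rfl, hw⟩
      have hw : ρ.fo x = w := hw
      rw [← hw] at hb
      exact hb
  | edge i x y =>
    have hx : Sum.inl x ∈ U := hφ (by simp [vars])
    have hy : Sum.inl y ∈ U := hφ (by simp [vars])
    obtain ⟨L, hL, h⟩ := recognizable_edge (A := A) i x y hx hy
    refine ⟨L, hL, fun ξ ρ hρ => ?_⟩
    rw [h]
    exact ⟨fun h => ⟨hρ x (by simp [free]), hρ y (by simp [free]), h⟩, fun h => h.2.2⟩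
  | mem x X =>
    have hx : Sum.inl x ∈ U := hφ (by simp [vars])
    have hX : Sum.inr X ∈ U := hφ (by simp [vars])
    obtain ⟨L, hL, h⟩ := recognizable_exists_node (A := A) (U := U)
      fun b => (⟨_, hx⟩ : U) ∈ b.2 ∧ (⟨_, hX⟩ : U) ∈ b.2
    refine ⟨L, hL, fun ξ ρ hρ => ?_⟩
    rw [h]
    constructor
    · intro h
      obtain ⟨a, ha⟩ := ξ.exists_labelAt _ (hρ x (by simp [free]))
      exact ⟨_, a, ha, rfl, h⟩
    · rintro ⟨w, b, _, hw, hw'⟩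
      have hw : ρ.fo x = w := hw
      have hw' : w ∈ ρ.so X := hw'
      rw [← hw] at hw'
      exact hw'
  | not φ ih => exact (ih hφ).not
  | or φ ψ ih₁ ih₂ =>
    obtain ⟨L₁, hL₁, h₁⟩ := ih₁ (Finset.union_subset_left hφ)
    obtain ⟨L₂, hL₂, h₂⟩ := ih₂ (Finset.union_subset_right hφ)
    exact ⟨_, hL₁.or hL₂, fun ξ ρ hρ => or_congr
      (h₁ ξ ρ (hρ.mono Finset.subset_union_left)) (h₂ ξ ρ (hρ.mono Finset.subset_union_right))⟩
  | and φ ψ ih₁ ih₂ =>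
    obtain ⟨L₁, hL₁, h₁⟩ := ih₁ (Finset.union_subset_left hφ)
    obtain ⟨L₂, hL₂, h₂⟩ := ih₂ (Finset.union_subset_right hφ)
    exact ⟨_, hL₁.and hL₂, fun ξ ρ hρ => and_congr
      (h₁ ξ ρ (hρ.mono Finset.subset_union_left)) (h₂ ξ ρ (hρ.mono Finset.subset_union_right))⟩
  | existsFO x φ ih =>
    exact (ih ((Finset.subset_insert _ _).trans hφ)).existsFO (hφ (Finset.mem_insert_self _ _))
  | forallFO x φ ih =>
    have h := ((ih ((Finset.subset_insert _ _).trans hφ)).not.existsFO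
      (hφ (Finset.mem_insert_self _ _))).not
    simp only [not_exists, not_and, not_not] at h
    exact h
  | existsSO X φ ih => exact (ih ((Finset.subset_insert _ _).trans hφ)).existsSO
  | forallSO X φ ih =>
    have h := (ih ((Finset.subset_insert _ _).trans hφ)).not.existsSO (X := X).not
    simp only [not_exists, not_and, not_not] at h
    exact h

/-! ### Weighted tree automata -/

/-- A weighted tree automaton over a complete M-monoid.  The transitions on the symbol `a` form an
arbitrary finite type (so there may be several ones between the same states); each one carries an
operation from `Ω`. -/
structure WTA (D : RankedAlphabet) (K : Type u) [CompleteMMonoid K] where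
  Q : Type
  T : D.carrier → Type
  [fintypeQ : Fintype Q]
  [fintypeT : ∀ a, Fintype (T a)]
  src : {a : D.carrier} → T a → Fin (D.rk a) → Q
  tgt : {a : D.carrier} → T a → Q
  op : {a : D.carrier} → T a → Op K (D.rk a)
  op_mem : ∀ {a : D.carrier} (τ : T a), op τ ∈ Ops (K := K) (D.rk a)

namespace WTA

attribute [instance] WTA.fintypeQ WTA.fintypeT

variable {D A : RankedAlphabet} {U : Finset Var} {K : Type u} [CompleteMMonoid K]

open Classical in
/-- The value of a tree at a state, by initial algebra semantics.  If the operations are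
distributive, it is the sum of the weights of all runs that end in this state. -/
noncomputable def val (M : WTA D K) : RTree D → M.Q → K :=
  RTree.hom (K := M.Q → K) fun a v q =>
    ∑ τ : M.T a, if M.tgt τ = q then M.op τ (fun i => v i (M.src τ i)) else 0

open Classical in
theorem val_node (M : WTA D K) (a : D.carrier) (c : Fin (D.rk a) → RTree D) (q : M.Q) :
    M.val (RTree.node a c) q =
      ∑ τ : M.T a, if M.tgt τ = q then M.op τ (fun i => M.val (c i) (M.src τ i)) else 0 :=
  rfl

open Classical in
/-- The tree series recognized by an automaton with the set `F` of final states. -/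
noncomputable def series (M : WTA D K) (F : Set M.Q) (t : RTree D) : K :=
  ∑ q, if q ∈ F then M.val t q else 0

/-- The automaton that computes the homomorphism given by `ω`. -/
abbrev ofHom (ω : (a : D.carrier) → Ops (K := K) (D.rk a)) : WTA D K where
  Q := Unit
  T _ := Unit
  src _ _ := ()
  tgt _ := ()
  op {a} _ := (ω a).val
  op_mem {a} _ := (ω a).2

theorem val_ofHom (ω : (a : D.carrier) → Ops (K := K) (D.rk a)) (t : RTree D) (q : Unit) :
    (ofHom ω).val t q = t.hom fun a => (ω a).val := by
  induction t with
  | node a c ih =>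
    rw [val_node, RTree.hom]
    simp only [← ih]
    exact (Fintype.sum_unique (ι := Unit) _).trans (if_pos trivial)

/-- The disjoint union of two automata. -/
abbrev disjUnion (M N : WTA D K) : WTA D K where
  Q := M.Q ⊕ N.Q
  T a := M.T a ⊕ N.T a
  src := Sum.elim (fun τ i => Sum.inl (M.src τ i)) fun τ i => Sum.inr (N.src τ i)
  tgt := Sum.elim (fun τ => Sum.inl (M.tgt τ)) fun τ => Sum.inr (N.tgt τ)
  op := Sum.elim M.op N.op
  op_mem := by
    rintro a (τ | τ)
    · exact M.op_mem τ
    · exact N.op_mem τ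

theorem val_disjUnion (M N : WTA D K) (t : RTree D) :
    (∀ q, (M.disjUnion N).val t (Sum.inl q) = M.val t q) ∧
      ∀ q, (M.disjUnion N).val t (Sum.inr q) = N.val t q := by
  classical
  induction t with
  | node a c ih =>
    constructor
    · intro q
      rw [val_node, val_node]
      refine (Fintype.sum_sum_type _).trans ?_
      simp [disjUnion, ← (ih _).1]
    · intro q
      rw [val_node, val_node]
      refine (Fintype.sum_sum_type _).trans ?_
      simp [disjUnion, ← (ih _).2]

/-- The product of a weighted automaton with a finite algebra. -/
abbrev prodAlg (M : WTA D K) {R : Type} [Fintype R] (δ : (a : D.carrier) → Op R (D.rk a)) :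
    WTA D K where
  Q := M.Q × R
  T a := M.T a × (Fin (D.rk a) → R)
  src τ i := (M.src τ.1 i, τ.2 i)
  tgt {a} τ := (M.tgt τ.1, δ a τ.2)
  op τ := M.op τ.1
  op_mem τ := M.op_mem τ.1

open Classical in
theorem val_prodAlg (M : WTA D K) {R : Type} [Fintype R] (δ : (a : D.carrier) → Op R (D.rk a))
    (t : RTree D) (q : M.Q) (r : R) :
    (M.prodAlg δ).val t (q, r) = if t.hom δ = r then M.val t q else 0 := by
  induction t generalizing q r with
  | node a c ih =>
    rw [val_node, val_node, RTree.hom]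
    refine (Fintype.sum_prod_type _).trans ?_
    have h : ∀ τ : M.T a, (∑ rs : Fin (D.rk a) → R,
        if (M.prodAlg δ).tgt (τ, rs) = (q, r) then
          (M.prodAlg δ).op (τ, rs)
            (fun i => (M.prodAlg δ).val (c i) ((M.prodAlg δ).src (τ, rs) i)) else 0) =
        if (δ a fun i => (c i).hom δ) = r then
          if M.tgt τ = q then M.op τ (fun i => M.val (c i) (M.src τ i)) else 0 else 0 := by
      intro τ
      rw [Fintype.sum_eq_single fun i => (c i).hom δ]
      · simp only [prodAlg, Prod.mk.injEq] at ih ⊢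
        simp only [ih, if_true, ite_and]
        split_ifs <;> rfl
      · intro rs hrs
        obtain ⟨i, hi⟩ := Function.ne_iff.1 hrs
        refine ite_eq_right_iff.2 fun _ => apply_zero_of_mem_Ops (M.op_mem τ) i ?_
        exact (ih i _ _).trans (if_neg (Ne.symm hi))
    refine (Finset.sum_congr rfl fun τ _ => Eq.trans (Finset.sum_congr rfl fun rs _ =>
      by congr) (h τ)).trans ?_
    split_ifs
    · rfl
    · exact Finset.sum_const_zero

/-- The automaton that guesses the marks for the variable `v`. -/
abbrev guess (M : WTA (A.ext U) K) (v : Var) : WTA (A.ext U) K where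
  Q := M.Q
  T a := Σ b : Bool, M.T (a.1, RTree.setMark v (b = true) a.2)
  src {a} τ := M.src (a := (a.1, RTree.setMark v (τ.1 = true) a.2)) τ.2
  tgt τ := M.tgt τ.2
  op {a} τ := M.op (a := (a.1, RTree.setMark v (τ.1 = true) a.2)) τ.2
  op_mem τ := M.op_mem τ.2

/-- This is where distributivity of the operations in `Ω` enters. -/
theorem val_guess (hK : Compressible K) (M : WTA (A.ext U) K) (v : Var) (t : RTree (A.ext U))
    (q : M.Q) :
    (M.guess v).val t q = ∑ W ∈ t.pos.powerset, M.val (t.mark v fun u => u ∈ W) q := by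
  classical
  induction t generalizing q with
  | node a c ih =>
    rw [val_node, RTree.sum_powerset_pos_node]
    refine (Fintype.sum_sigma _).trans (Finset.sum_congr rfl fun b _ => ?_)
    simp only [RTree.mark_joinPos, val_node]
    rw [Finset.sum_comm]
    refine Finset.sum_congr rfl fun τ _ => ?_
    rw [Finset.sum_ite_irrel, Finset.sum_const_zero]
    refine if_congr Iff.rfl ?_ rfl
    rw [← hK.map_sum_piFinset (M.op_mem τ) (fun i => (c i).pos.powerset)
      fun i W => M.val ((c i).mark v fun u => u ∈ W) (M.src τ i)]
    have : ∀ i, (M.guess v).val (c i) (M.src τ i) = _ := fun i => ih i (M.src τ i)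
    simp only [← this]

/-- The restriction of an automaton on marked trees to the trees without marks. -/
abbrev unmarked (M : WTA (A.ext U) K) : WTA A K where
  Q := M.Q
  T a := M.T (a, ∅)
  src τ := M.src τ
  tgt τ := M.tgt τ
  op τ := M.op τ
  op_mem τ := M.op_mem τ

theorem val_unmarked (M : WTA (A.ext U) K) {ρ : Assignment} (t : RTree A) :
    ∀ w, (∀ u ∈ t.pos, ∀ v ∈ U, ¬ ρ.Marks (w ++ u) v) → ∀ q,
      M.unmarked.val t q = M.val (t.encode U ρ w) q := by
  classical
  induction t with
  | node a c ih =>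
    intro w hw q
    have h₀ : {v : U | ρ.Marks w v} = ∅ := by
      ext v
      simpa using hw [] (RTree.nil_mem_pos _) v v.2
    have h : ∀ i, M.unmarked.val (c i) = M.val ((c i).encode U ρ (w ++ [i.val + 1])) := by
      intro i
      funext q
      refine ih i _ (fun u hu v hv => ?_) q
      simpa using hw _ (RTree.cons_mem_pos_node.2 hu) v hv
    rw [RTree.encode, h₀, val_node, val_node]
    simp only [h]

end WTA

/-- A tree series is recognizable if some weighted tree automaton recognizes it. -/
def RecognizableSeries {D : RankedAlphabet} {K : Type u} [CompleteMMonoid K] (s : RTree D → K) :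
    Prop :=
  ∃ (M : WTA D K) (F : Set M.Q), ∀ t, s t = M.series F t

namespace RecognizableSeries

variable {D A : RankedAlphabet} {U : Finset Var} {K : Type u} [CompleteMMonoid K]

theorem hom (ω : (a : D.carrier) → Ops (K := K) (D.rk a)) :
    RecognizableSeries fun t : RTree D => t.hom fun a => (ω a).val := by
  classical
  refine ⟨WTA.ofHom ω, Set.univ, fun t => ?_⟩
  beta_reduce
  rw [WTA.series, ← WTA.val_ofHom ω t ()]
  simp only [Set.mem_univ, if_true]
  exact (Fintype.sum_unique (ι := Unit) _).symm

theorem add {s s' : RTree D → K} (h : RecognizableSeries s) (h' : RecognizableSeries s') :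
    RecognizableSeries fun t => s t + s' t := by
  obtain ⟨M, F, h⟩ := h
  obtain ⟨N, G, h'⟩ := h'
  refine ⟨M.disjUnion N, {q | Sum.elim (fun q => q ∈ F) (fun q => q ∈ G) q}, fun t => ?_⟩
  beta_reduce
  rw [h, h', WTA.series, WTA.series, WTA.series]
  refine Eq.symm ((Fintype.sum_sum_type _).trans ?_)
  simp only [(M.val_disjUnion N t).1, (M.val_disjUnion N t).2]
  rfl

open Classical in
theorem guard {s : RTree D → K} (h : RecognizableSeries s) {L : RTree D → Prop}
    (hL : Recognizable L) : RecognizableSeries fun t => if L t then s t else 0 := by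
  obtain ⟨M, F, h⟩ := h
  obtain ⟨R, _, δ, G, hL⟩ := hL
  let _ : Fintype R := Fintype.ofFinite R
  refine ⟨M.prodAlg δ, F ×ˢ G, fun t => ?_⟩
  beta_reduce
  rw [h, WTA.series, WTA.series]
  refine Eq.symm ((Fintype.sum_prod_type _).trans ?_)
  simp only [M.val_prodAlg δ, Set.mem_prod, hL]
  have h : ∀ q, (∑ r, if q ∈ F ∧ r ∈ G then if t.hom δ = r then M.val t q else 0 else 0) =
      if t.hom δ ∈ G then if q ∈ F then M.val t q else 0 else 0 := by
    intro q
    rw [Fintype.sum_eq_single (t.hom δ)]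
    · by_cases hq : q ∈ F <;> simp [hq]
    · intro r hr
      simp [Ne.symm hr]
  rw [Finset.sum_congr rfl fun q _ => h q, Finset.sum_ite_irrel, Finset.sum_const_zero]

theorem sum_mark (hK : Compressible K) {s : RTree (A.ext U) → K} (h : RecognizableSeries s)
    (v : Var) :
    RecognizableSeries fun t => ∑ W ∈ t.pos.powerset, s (t.mark v fun u => u ∈ W) := by
  classical
  obtain ⟨M, F, h⟩ := h
  refine ⟨M.guess v, F, fun t => ?_⟩
  simp only [h, WTA.series]
  rw [Finset.sum_comm]
  refine Finset.sum_congr rfl fun q _ => ?_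
  rw [Finset.sum_ite_irrel, Finset.sum_const_zero, M.val_guess hK]

end RecognizableSeries

/-! ### From M-expressions to weighted tree automata -/

section

variable {A : RankedAlphabet} {U : Finset Var} {K : Type u}

/-- All variables that occur in an M-expression, free or bound. -/
def MExp.vars [CompleteMMonoid K] : MExp A K → Finset Var
  | H V _ => V
  | add e₁ e₂ => e₁.vars ∪ e₂.vars
  | guard φ e => φ.vars ∪ e.vars
  | sumFO x e => insert (Sum.inl x) e.vars
  | sumSO X e => insert (Sum.inr X) e.vars

/-- More variables in the encoding do not matter for a homomorphism that ignores them. -/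
theorem RTree.hom_encode_of_subset {V : Finset Var} (hV : V ⊆ U)
    (ω : (a : (A.ext V).carrier) → Op K ((A.ext V).rk a)) (ρ : Assignment) (ξ : RTree A) :
    ∀ w, (encode U ρ w ξ).hom (fun a : (A.ext U).carrier => ω (a.1, {v | ⟨v.1, hV v.2⟩ ∈ a.2})) =
      (encode V ρ w ξ).hom ω := by
  induction ξ with
  | node a c ih =>
    intro w
    simp only [encode, hom, ih]
    rfl

theorem MExp.recognizes [CompleteMMonoid K] (hK : Compressible K) (e : MExp A K) (he : e.vars ⊆ U) :
    ∃ s : RTree (A.ext U) → K, RecognizableSeries s ∧ ∀ ξ ρ, ρ.Valid e.free ξ →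
      e.eval ξ ρ = s (RTree.encode U ρ [] ξ) := by
  classical
  induction e with
  | H V ω =>
    refine ⟨_, RecognizableSeries.hom fun a : (A.ext U).carrier =>
      ω (a.1, {v | ⟨v.1, he v.2⟩ ∈ a.2}), fun ξ ρ _ => ?_⟩
    exact (RTree.hom_encode_of_subset (V := V) he (fun a => (ω a).val) ρ ξ []).symm
  | add e₁ e₂ ih₁ ih₂ =>
    obtain ⟨s₁, hs₁, h₁⟩ := ih₁ (Finset.union_subset_left he)
    obtain ⟨s₂, hs₂, h₂⟩ := ih₂ (Finset.union_subset_right he)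
    refine ⟨_, hs₁.add hs₂, fun ξ ρ hρ => ?_⟩
    rw [eval, h₁ ξ ρ (hρ.mono Finset.subset_union_left),
      h₂ ξ ρ (hρ.mono Finset.subset_union_right)]
  | guard φ e ih =>
    obtain ⟨L, hL, hφ⟩ := φ.recognizes (Finset.union_subset_left he)
    obtain ⟨s, hs, h⟩ := ih (Finset.union_subset_right he)
    refine ⟨_, hs.guard hL, fun ξ ρ hρ => ?_⟩
    exact if_congr (hφ ξ ρ (hρ.mono Finset.subset_union_left))
      (h ξ ρ (hρ.mono Finset.subset_union_right)) rfl
  | sumFO x e ih =>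
    obtain ⟨s, hs, h⟩ := ih ((Finset.subset_insert _ _).trans he)
    have hx : Sum.inl x ∈ U := he (Finset.mem_insert_self _ _)
    -- A first-order variable is a second-order variable with exactly one element.
    refine ⟨_, (hs.guard (recognizable_countMarks_eq_one ⟨_, hx⟩)).sum_mark hK (Sum.inl x),
      fun ξ ρ hρ => ?_⟩
    rw [RTree.pos_encode]
    have h₁ : ∀ W ∈ ξ.pos.powerset,
        RTree.countMarks ⟨_, hx⟩ (RTree.mark (Sum.inl x) (fun u => u ∈ W)
          (RTree.encode U ρ [] ξ)) = W.card := fun W hW =>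
      RTree.countMarks_mark ⟨_, hx⟩ _ W (by rwa [RTree.pos_encode, ← Finset.mem_powerset])
    trans ∑ W ∈ ξ.pos.powerset, if W.card = 1 then
      s ((RTree.encode U ρ [] ξ).mark (Sum.inl x) fun u => u ∈ W) else 0
    swap
    · refine Finset.sum_congr rfl fun W hW => ?_
      by_cases hc : W.card = 1 <;> simp [h₁ W hW, hc]
    rw [← Finset.sum_filter, ← Finset.powersetCard_eq_filter, Finset.powersetCard_one,
      Finset.sum_map, eval]
    refine Finset.sum_congr rfl fun w hw => ?_
    rw [h ξ _ (hρ.updFO hw), ← RTree.mark_encode_updFO]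
    rfl
  | sumSO X e ih =>
    obtain ⟨s, hs, h⟩ := ih ((Finset.subset_insert _ _).trans he)
    refine ⟨_, hs.sum_mark hK (Sum.inr X), fun ξ ρ hρ => ?_⟩
    rw [RTree.pos_encode, eval]
    refine Finset.sum_congr rfl fun W _ => ?_
    rw [h ξ _ (hρ.updSO W), ← RTree.mark_encode_updSO]

end

/-! ### Behaviours of the trivial storage type -/

section Strip

variable {D A : RankedAlphabet}

/-- Delete the symbols `⟨d, *⟩` and replace `⟨d, a⟩` by `a`. -/
def RTree.strip : RTree (extension D A) → RTree A
  | node (Sum.inl _) c => strip (c (0 : Fin 1))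
  | node (Sum.inr q) c => node q.val.2 fun i => strip (c i)

/-- The mapping `strip` for trees that are not completely rewritten; symbols of `A` are kept. -/
def RTree.stripSum : RTree (A.sum (extension D A)) → RTree A
  | node (Sum.inl a) c => node a fun i => stripSum (c i)
  | node (Sum.inr (Sum.inl _)) c => stripSum (c (0 : Fin 1))
  | node (Sum.inr (Sum.inr q)) c => node q.val.2 fun i => stripSum (c i)

theorem RTree.stripSum_inl (ξ : RTree A) :
    stripSum (D := D) (ξ.map (B := A.sum (extension D A)) Sum.inl fun _ => rfl) = ξ := by
  induction ξ with
  | node a c ih => exact congrArg (node a) (funext fun i => ih i)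

theorem RTree.stripSum_inr (ζ : RTree (extension D A)) :
    stripSum (ζ.map (B := A.sum (extension D A)) Sum.inr fun _ => rfl) = ζ.strip := by
  induction ζ with
  | node b c ih =>
    rcases b with d | q
    · exact ih (0 : Fin 1)
    · exact congrArg (node q.val.2) (funext fun i => ih i)

/-- The rewrite relation does not change the tree without its new symbols. -/
theorem Rewrite.stripSum_eq {t t' : RTree (A.sum (extension D A))} (h : Rewrite D A t t') :
    t.stripSum = t'.stripSum := by
  induction h with
  | chain a c d hd => rfl
  | label a c d hd => rfl
  | child b c i t _ ih =>
    have h : ∀ j, (c j).stripSum = (Function.update c i t j).stripSum := by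
      intro j
      by_cases hj : j = i
      · subst hj
        rw [ih, Function.update_self]
      · rw [Function.update_of_ne hj]
    rcases b with a | d | q
    · exact congrArg (RTree.node a) (funext h)
    · exact h (0 : Fin 1)
    · exact congrArg (RTree.node q.val.2) (funext h)

theorem Rewrite.node_of_children {b : (A.sum (extension D A)).carrier}
    {c c' : Fin ((A.sum (extension D A)).rk b) → RTree (A.sum (extension D A))}
    (h : ∀ i, Relation.ReflTransGen (Rewrite D A) (c i) (c' i)) :
    Relation.ReflTransGen (Rewrite D A) (RTree.node b c) (RTree.node b c') := by
  classical
  have single : ∀ (c : Fin ((A.sum (extension D A)).rk b) → RTree (A.sum (extension D A))) i t,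
      Relation.ReflTransGen (Rewrite D A) (c i) t →
      Relation.ReflTransGen (Rewrite D A) (RTree.node b c)
        (RTree.node b (Function.update c i t)) := by
    intro c i t ht
    induction ht with
    | refl => rw [Function.update_eq_self]
    | tail _ h ih =>
      refine ih.tail ?_
      have := Rewrite.child b (Function.update c i _) i _
        (by rw [Function.update_self]; exact h)
      rwa [Function.update_idem] at this
  have all : ∀ s : Finset (Fin ((A.sum (extension D A)).rk b)),
      Relation.ReflTransGen (Rewrite D A) (RTree.node b c) (RTree.node b (s.piecewise c' c)) := by
    intro s
    induction s using Finset.induction_on with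
    | empty => rw [Finset.piecewise_empty]
    | insert i s hi ih =>
      rw [Finset.piecewise_insert]
      refine ih.trans (single _ i _ ?_)
      rw [Finset.piecewise_eq_of_notMem _ _ _ hi]
      exact h i
  simpa using all Finset.univ

theorem RTree.rewrite_strip (ζ : RTree (extension D A)) :
    Relation.ReflTransGen (Rewrite D A) (ζ.strip.map Sum.inl fun _ => rfl)
      (ζ.map Sum.inr fun _ => rfl) := by
  induction ζ with
  | node b c ih =>
    rcases b with d | q
    · cases hs : (c (0 : Fin 1)).strip with
      | node a c' =>
        have h₁ : (RTree.node (A := extension D A) (Sum.inl d) c).strip = RTree.node a c' := hs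
        rw [h₁]
        refine Relation.ReflTransGen.head (Rewrite.chain a _ d.1 d.2) ?_
        refine Rewrite.node_of_children fun i => ?_
        have hi : i = (0 : Fin 1) := Subsingleton.elim (α := Fin 1) _ _
        have h₂ := ih (0 : Fin 1)
        rw [hs] at h₂
        rw [hi]
        exact h₂
    · refine Relation.ReflTransGen.head (Rewrite.label q.1.2 _ q.1.1 q.2) ?_
      exact Rewrite.node_of_children fun i => ih i

/-- For the trivial storage type, every tree over the corresponding alphabet is a behaviour. -/
theorem mem_behavioursOn_TRIV {n : ℕ} {P' : Finset (TRIV.C → Bool)}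
    {F' : Finset (TRIV.C → Option TRIV.C)} {hP : P'.Nonempty}
    (hP' : (P' : Set (TRIV.C → Bool)) ⊆ TRIV.P)
    (hF' : (F' : Set (TRIV.C → Option TRIV.C)) ⊆ TRIV.F) (ξ : RTree A)
    (ζ : RTree (extension (corresponding n P' F' hP) A)) :
    ζ ∈ behavioursOn TRIV.c₀ ξ ↔ ζ.strip = ξ := by
  constructor
  · rintro ⟨h, _⟩
    have h' : ∀ {t t'}, Relation.ReflTransGen (Rewrite (corresponding n P' F' hP) A) t t' →
        t.stripSum = t'.stripSum := by
      intro t t' h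
      induction h with
      | refl => rfl
      | tail _ h ih => exact ih.trans h.stripSum_eq
    have := h' h
    rwa [RTree.stripSum_inl, RTree.stripSum_inr, eq_comm] at this
  · rintro rfl
    refine ⟨ζ.rewrite_strip, fun _ => TRIV.c₀, rfl, fun w _ d _ => ⟨?_, fun i => ?_⟩⟩
    · have h : d.2.1.val = fun _ => true := hP' d.2.1.2
      rw [h]
    · have h : (d.2.2 i).val = fun c => some c := hF' (d.2.2 i).2
      rw [h]

theorem compose_behavioursOn_TRIV {n : ℕ} {P' : Finset (TRIV.C → Bool)}
    {F' : Finset (TRIV.C → Option TRIV.C)} {hP : P'.Nonempty}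
    (hP' : (P' : Set (TRIV.C → Bool)) ⊆ TRIV.P)
    (hF' : (F' : Set (TRIV.C → Option TRIV.C)) ⊆ TRIV.F) {K : Type u} [CompleteAddMonoid K]
    (s : RTree (extension (corresponding n P' F' hP) A) → K) (ξ : RTree A) :
    compose (behavioursOn TRIV.c₀) s ξ =
      csum fun ζ : {ζ : RTree (extension (corresponding n P' F' hP) A) // ζ.strip = ξ} => s ζ :=
  csum_equiv (Equiv.subtypeEquivRight fun ζ => mem_behavioursOn_TRIV hP' hF' ξ ζ)
    fun ζ : {ζ : RTree (extension (corresponding n P' F' hP) A) // ζ.strip = ξ} => s ζ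

end Strip

/-! ### Elimination of chains -/

section Chain

variable {D A : RankedAlphabet} {K : Type u} [CompleteMMonoid K]

/-- The symbols `d` that occur in the symbols `⟨d, *⟩`. -/
abbrev ChainSymbol (D : RankedAlphabet) : Type := {d : D.carrier // D.rk d = 1}

/-- Put a chain of symbols `⟨d, *⟩` on top of a tree. -/
def RTree.chain : List (ChainSymbol D) → RTree (extension D A) → RTree (extension D A)
  | [], η => η
  | d :: ds, η => node (A := extension D A) (Sum.inl d) fun _ => chain ds η

/-- The tree with the root label `⟨d, a⟩`. -/
abbrev RTree.labelNode {a : A.carrier} (d : {d : D.carrier // D.rk d = A.rk a})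
    (c : Fin (A.rk a) → RTree (extension D A)) : RTree (extension D A) :=
  node (A := extension D A) (Sum.inr ⟨(d.1, a), d.2⟩) c

theorem RTree.chain_labelNode_inj {a : A.carrier} {d d' : {d : D.carrier // D.rk d = A.rk a}}
    {c c' : Fin (A.rk a) → RTree (extension D A)} :
    ∀ {ds ds' : List (ChainSymbol D)}, chain ds (labelNode d c) = chain ds' (labelNode d' c') →
      ds = ds' ∧ d = d' ∧ c = c' := by
  intro ds
  induction ds with
  | nil =>
    rintro (_ | ⟨e, ds'⟩) h
    · have h' := node.inj h
      simp only [Sum.inr.injEq, Subtype.mk.injEq, Prod.mk.injEq, and_true] at h'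
      exact ⟨rfl, Subtype.ext h'.1, eq_of_heq h'.2⟩
    · cases (node.inj h).1
  | cons e ds ih =>
    rintro (_ | ⟨e', ds'⟩) h
    · cases (node.inj h).1
    · simp only [chain, node.injEq, Sum.inl.injEq] at h
      obtain ⟨rfl, h⟩ := h
      obtain ⟨rfl, h'⟩ := ih (congrFun (eq_of_heq h) (0 : Fin 1))
      exact ⟨rfl, h'⟩

theorem RTree.strip_chain (ds : List (ChainSymbol D)) (η : RTree (extension D A)) :
    (chain ds η).strip = η.strip := by
  induction ds with
  | nil => rfl
  | cons d ds ih => exact ih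

theorem RTree.exists_chain {a : A.carrier} {c : Fin (A.rk a) → RTree A}
    (ζ : RTree (extension D A)) (h : ζ.strip = node a c) :
    ∃ ds d c', (∀ i, (c' i).strip = c i) ∧ ζ = chain ds (labelNode d c') := by
  induction ζ with
  | node b c₀ ih =>
    rcases b with d | ⟨⟨d, a'⟩, hd⟩
    · obtain ⟨ds, d', c', hc', h'⟩ := ih (0 : Fin 1) h
      refine ⟨d :: ds, d', c', hc', ?_⟩
      rw [chain, ← h']
      congr 1
      funext i
      exact congrArg c₀ (Subsingleton.elim (α := Fin 1) i 0)
    · simp only [strip, node.injEq] at h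
      obtain ⟨rfl, h⟩ := h
      exact ⟨[], ⟨d, hd⟩, c₀, fun i => congrFun (eq_of_heq h) i, rfl⟩

/-- A tree over `⟨D, A⟩` that lies above `a(c₁, …, c_k)` consists of a chain, a label at its lower
end, and trees above `c₁, …, c_k`. -/
noncomputable def chainEquiv (a : A.carrier) (c : Fin (A.rk a) → RTree A) :
    List (ChainSymbol D) × {d : D.carrier // D.rk d = A.rk a} ×
      ((i : Fin (A.rk a)) → {ζ : RTree (extension D A) // ζ.strip = c i}) ≃
    {ζ : RTree (extension D A) // ζ.strip = RTree.node a c} :=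
  Equiv.ofBijective
    (fun x => ⟨RTree.chain x.1 (RTree.labelNode x.2.1 fun i => (x.2.2 i).1),
      (RTree.strip_chain _ _).trans (congrArg (RTree.node a) (funext fun i => (x.2.2 i).2))⟩)
    ⟨by
      rintro ⟨ds, d, ζ⟩ ⟨ds', d', ζ'⟩ h
      obtain ⟨rfl, rfl, h⟩ := RTree.chain_labelNode_inj (Subtype.ext_iff.1 h)
      have : ζ = ζ' := funext fun i => Subtype.ext (congrFun h i)
      rw [this],
    by
      rintro ⟨ζ, hζ⟩
      obtain ⟨ds, d, c', hc', rfl⟩ := RTree.exists_chain ζ hζ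
      exact ⟨(ds, d, fun i => ⟨c' i, hc' i⟩), rfl⟩⟩

namespace WTA

variable (M : WTA (extension D A) K)

open Classical in
/-- The operation by which a chain transforms a value at the state `p` below the chain into a
contribution to the value at the state `q` above the chain. -/
noncomputable def chainOp : List (ChainSymbol D) → M.Q → M.Q → Op K 1
  | [], p, q => fun v => if p = q then v 0 else 0
  | d :: ds, p, q => fun v => ∑ τ : M.T (Sum.inl d),
      if M.tgt τ = q then M.op τ (fun _ => chainOp ds p (M.src τ (0 : Fin 1)) v) else 0

open Classical in
theorem val_labelNode {a : A.carrier} (d : {d : D.carrier // D.rk d = A.rk a})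
    (c : Fin (A.rk a) → RTree (extension D A)) (q : M.Q) :
    M.val (RTree.labelNode d c) q = ∑ τ : M.T (Sum.inr ⟨(d.1, a), d.2⟩),
      if M.tgt τ = q then M.op τ (fun i => M.val (c i) (M.src τ i)) else 0 :=
  rfl

/-- The sum of the operations of all chains. -/
noncomputable def chainSum (p q : M.Q) : Op K 1 := fun v => csum fun ds => M.chainOp ds p q v

variable {M}

theorem chainOp_mem (hK : Compressible K) (ds : List (ChainSymbol D)) (p q : M.Q) :
    M.chainOp ds p q ∈ Ops (K := K) 1 := by
  classical
  induction ds generalizing q with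
  | nil =>
    by_cases h : p = q
    · simpa [chainOp, h] using hK.identity
    · simpa [chainOp, h] using CompleteMMonoid.zero_mem (K := K) 1
  | cons d ds ih =>
    have h := hK.oneSum (M.T (Sum.inl d)) (fun τ v =>
      if M.tgt τ = q then M.op τ (fun _ => M.chainOp ds p (M.src τ (0 : Fin 1)) v) else 0) (by
        intro τ
        by_cases h : M.tgt τ = q
        · simp only [h, if_true]
          exact hK.composition 1 _ (M.op_mem τ) _ (ih _)
        · simp only [h, if_false]
          exact CompleteMMonoid.zero_mem (K := K) 1)
    simp only [CompleteAddMonoid.csum_of_fintype] at h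
    exact h

theorem chainSum_mem (hK : Compressible K) (p q : M.Q) : M.chainSum p q ∈ Ops (K := K) 1 :=
  hK.oneSum _ _ fun ds => chainOp_mem hK ds p q

theorem val_chain (hK : Compressible K) (ds : List (ChainSymbol D)) (η : RTree (extension D A))
    (q : M.Q) :
    M.val (RTree.chain ds η) q = ∑ p, M.chainOp ds p q fun _ => M.val η p := by
  classical
  induction ds generalizing q with
  | nil => simp [RTree.chain, chainOp]
  | cons d ds ih =>
    rw [RTree.chain, val_node]
    simp only [chainOp]
    rw [Finset.sum_comm]
    refine Finset.sum_congr rfl fun τ _ => ?_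
    rw [Finset.sum_ite_irrel, Finset.sum_const_zero]
    refine if_congr Iff.rfl ?_ rfl
    have h : (fun i => M.val (RTree.chain ds η) (M.src τ i)) =
        fun _ => ∑ p, M.chainOp ds p (M.src τ (0 : Fin 1)) fun _ => M.val η p := by
      funext i
      rw [← ih, Subsingleton.elim (α := Fin 1) i 0]
    rw [h]
    exact hK.map_sum_one (M.op_mem τ) _

variable (M) in
/-- The automaton on `A` that simulates `M` on all trees over `⟨D, A⟩` that lie above its input.
Since `Ω` is closed under sums only for unary operations, a transition consists of the transition
of `M` at the label `⟨d, a⟩` and the state of `M` at the upper end of the chain. -/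
noncomputable abbrev compress (hK : Compressible K) : WTA A K where
  Q := M.Q
  T a := (Σ d : {d : D.carrier // D.rk d = A.rk a}, M.T (Sum.inr ⟨(d.1, a), d.2⟩)) × M.Q
  fintypeT a :=
    have : Fintype {d : D.carrier // D.rk d = A.rk a} := Fintype.ofFinite _
    inferInstance
  src {a} τ := M.src (a := Sum.inr ⟨(τ.1.1.1, a), τ.1.1.2⟩) τ.1.2
  tgt τ := τ.2
  op {a} τ v := M.chainSum (M.tgt τ.1.2) τ.2
    fun _ => M.op (a := Sum.inr ⟨(τ.1.1.1, a), τ.1.1.2⟩) τ.1.2 v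
  op_mem τ := hK.composition _ _ (chainSum_mem hK _ _) _ (M.op_mem τ.1.2)

/-- The trees above `ξ` are decomposed by `chainEquiv` all at once. Splitting off one chain symbol at a
time would only yield a fixed point equation, which need not have a unique solution in `K`. -/
theorem val_compress (hK : Compressible K) (ξ : RTree A) (q : M.Q) :
    (M.compress hK).val ξ q =
      csum fun ζ : {ζ : RTree (extension D A) // ζ.strip = ξ} => M.val ζ q := by
  classical
  induction ξ generalizing q with
  | node a c ih =>
    let _ : Fintype {d : D.carrier // D.rk d = A.rk a} := Fintype.ofFinite _
    -- The contribution of a transition of `M`, summed over all trees above the direct subtrees.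
    let Y : (x : Σ d : {d : D.carrier // D.rk d = A.rk a}, M.T (Sum.inr ⟨(d.1, a), d.2⟩)) → K :=
      fun x => M.op x.2 fun i =>
        csum fun ζ : {ζ : RTree (extension D A) // ζ.strip = c i} => M.val ζ (M.src x.2 i)
    have hl : (M.compress hK).val (RTree.node a c) q =
        ∑ x, M.chainSum (M.tgt x.2) q fun _ => Y x := by
      rw [val_node]
      refine (Fintype.sum_prod_type _).trans (Finset.sum_congr rfl fun x _ => ?_)
      rw [Fintype.sum_eq_single q fun p hp => if_neg hp, if_pos rfl]
      simp only [ih]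
      rfl
    have hr : ∀ p, (csum fun y : {d : D.carrier // D.rk d = A.rk a} ×
        ((i : Fin (A.rk a)) → {ζ : RTree (extension D A) // ζ.strip = c i}) =>
          M.val (RTree.labelNode y.1 fun i => (y.2 i).1) p) =
        ∑ x : Σ d : {d : D.carrier // D.rk d = A.rk a}, M.T (Sum.inr ⟨(d.1, a), d.2⟩),
          if M.tgt x.2 = p then Y x else 0 := by
      intro p
      rw [csum_prod, CompleteAddMonoid.csum_of_fintype, Fintype.sum_sigma]
      refine Finset.sum_congr rfl fun d _ => ?_
      simp only [val_labelNode]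
      rw [csum_finset_sum]
      refine Finset.sum_congr rfl fun τ _ => ?_
      by_cases h : M.tgt τ = p
      · simp only [h, if_true]
        exact (hK.completelyDistributive (M.op_mem τ)
          (fun i => {ζ : RTree (extension D A) // ζ.strip = c i})
          fun i ζ => M.val ζ (M.src τ i)).symm
      · simp only [h, if_false, csum_zero]
    rw [hl, ← csum_equiv (chainEquiv a c), csum_prod]
    have hc : ∀ ds, (csum fun y : {d : D.carrier // D.rk d = A.rk a} ×
        ((i : Fin (A.rk a)) → {ζ : RTree (extension D A) // ζ.strip = c i}) =>
          M.val (chainEquiv a c (ds, y)).1 q) =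
        ∑ x, M.chainOp ds (M.tgt x.2) q fun _ => Y x := by
      intro ds
      have h₁ : ∀ y : {d : D.carrier // D.rk d = A.rk a} ×
          ((i : Fin (A.rk a)) → {ζ : RTree (extension D A) // ζ.strip = c i}),
          M.val (chainEquiv a c (ds, y)).1 q =
          ∑ p, M.chainOp ds p q fun _ => M.val (RTree.labelNode y.1 fun i => (y.2 i).1) p :=
        fun y => val_chain hK ds _ q
      simp only [h₁]
      rw [csum_finset_sum]
      have h₂ := fun p => hK.map_csum_one (chainOp_mem hK ds p q)
        fun y : {d : D.carrier // D.rk d = A.rk a} ×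
          ((i : Fin (A.rk a)) → {ζ : RTree (extension D A) // ζ.strip = c i}) =>
            M.val (RTree.labelNode y.1 fun i => (y.2 i).1) p
      simp only [← h₂, hr, hK.map_sum_one (chainOp_mem hK ds _ q)]
      rw [Finset.sum_comm]
      refine Finset.sum_congr rfl fun x _ => ?_
      rw [Fintype.sum_eq_single (M.tgt x.2)]
      · rw [if_pos rfl]
      · intro p hp
        exact apply_zero_of_mem_Ops (chainOp_mem hK ds p q) 0 (if_neg (Ne.symm hp))
    simp only [hc]
    rw [csum_finset_sum]
    rfl

end WTA

/-- A series that is definable with the trivial storage type is recognizable. -/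
theorem Definable.recognizableSeries (hK : Compressible K) {s : RTree A → K}
    (hs : Definable TRIV s) : RecognizableSeries s := by
  classical
  obtain ⟨P', F', hP, _, hP', hF', e, he, rfl⟩ := hs
  obtain ⟨_, ⟨M, F, hM⟩, h⟩ := e.recognizes (U := e.vars) hK subset_rfl
  refine ⟨M.unmarked.compress hK, F, fun ξ => ?_⟩
  -- Under this assignment no position of a tree is marked.
  let ρ : Assignment := ⟨fun _ => [0], fun _ => ∅⟩
  have hρ : ∀ ζ : RTree (extension (corresponding A.maxrk P' F' hP) A),
      e.sem ζ = ∑ q, if q ∈ F then M.unmarked.val ζ q else 0 := by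
    intro ζ
    have hfree : e.free = ∅ := he
    rw [MExp.sem, he.eval_eq ζ _ ρ, h ζ ρ (by simp [Assignment.Valid, hfree]), hM, WTA.series]
    refine Finset.sum_congr rfl fun q _ => if_congr Iff.rfl (Eq.symm ?_) rfl
    refine M.val_unmarked ζ [] (fun u hu v _ => ?_) q
    rcases v with x | X
    · rintro rfl
      cases ζ
      simp [ρ, RTree.mem_pos_node] at hu
    · simp [Assignment.Marks, ρ]
  rw [compose_behavioursOn_TRIV hP' hF', WTA.series]
  simp only [hρ]
  rw [csum_finset_sum]
  refine Finset.sum_congr rfl fun q _ => ?_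
  by_cases hq : q ∈ F
  · simp only [hq, if_true]
    exact (WTA.val_compress (M := M.unmarked) hK ξ q).symm
  · simp only [hq, if_false, csum_zero]

end Chain

/-! ### From weighted tree automata to M-expressions -/

section Formula

variable {A : RankedAlphabet}

/-- Every position but the root has a predecessor. -/
theorem RTree.eq_nil_or_eq_concat (ξ : RTree A) :
    ∀ w ∈ ξ.pos, w = [] ∨ ∃ u ∈ ξ.pos, ∃ i : Fin A.maxrk, w = u ++ [i.val + 1] := by
  induction ξ with
  | node a c ih =>
    intro w hw
    rcases mem_pos_node.1 hw with rfl | ⟨i, u, hu, rfl⟩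
    · exact Or.inl rfl
    · right
      rcases ih i u hu with rfl | ⟨u', hu', j, rfl⟩
      · have hi : i.val < A.maxrk :=
          i.2.trans_le (le_ciSup (Set.finite_range A.rk).bddAbove a)
        exact ⟨[], nil_mem_pos _, ⟨i, hi⟩, rfl⟩
      · exact ⟨(i.val + 1) :: u', cons_mem_pos_node.2 hu', j, rfl⟩

namespace MSO

/-- The disjunction of a list of formulas.  The empty disjunction is an unsatisfiable formula
without free variables. -/
noncomputable def disj : List (MSO A) → MSO A
  | [] => existsFO 0 ((label A.exists_nullary.choose 0).and (label A.exists_nullary.choose 0).not)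
  | φ :: l => φ.or (disj l)

theorem models_disj (ξ : RTree A) (ρ : Assignment) (l : List (MSO A)) :
    (disj l).Models ξ ρ ↔ ∃ φ ∈ l, φ.Models ξ ρ := by
  induction l with
  | nil =>
    simp only [List.not_mem_nil, false_and, exists_false, iff_false]
    rintro ⟨w, _, h, h'⟩
    exact h' h
  | cons φ l ih =>
    rw [List.exists_mem_cons_iff, ← ih]
    rfl

theorem free_disj_subset {V : Finset Var} (l : List (MSO A)) (h : ∀ φ ∈ l, φ.free ⊆ V) :
    (disj l).free ⊆ V := by
  induction l with
  | nil => simp [disj, free]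
  | cons φ l ih =>
    exact Finset.union_subset (h φ List.mem_cons_self)
      (ih fun ψ hψ => h ψ (List.mem_cons_of_mem _ hψ))

/-- Disjunction over the elements of a finite type with a given property. -/
noncomputable def disjOver {ι : Type} [Fintype ι] (p : ι → Prop) (φ : ι → MSO A) : MSO A :=
  open Classical in disj ((Finset.univ.filter p).toList.map φ)

theorem models_disjOver {ι : Type} [Fintype ι] (p : ι → Prop) (φ : ι → MSO A) (ξ : RTree A)
    (ρ : Assignment) : (disjOver p φ).Models ξ ρ ↔ ∃ i, p i ∧ (φ i).Models ξ ρ := by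
  simp [disjOver, models_disj]

theorem free_disjOver_subset {ι : Type} [Fintype ι] {V : Finset Var} (p : ι → Prop)
    (φ : ι → MSO A) (h : ∀ i, (φ i).free ⊆ V) : (disjOver p φ).free ⊆ V := by
  refine free_disj_subset _ fun ψ hψ => ?_
  obtain ⟨i, _, rfl⟩ := List.mem_map.1 hψ
  exact h i

end MSO

end Formula

namespace WTA

variable {A : RankedAlphabet} {K : Type u} [CompleteMMonoid K] (M : WTA A K)

/-- The transitions of an automaton, together with their symbols. -/
abbrev Transition : Type := Σ a, M.T a

variable (enc : M.Transition → ℕ)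

/-- The second-order variable that stands for the set of positions at which a run uses the
transition `x`. -/
abbrev code (x : M.Transition) : Var := Sum.inr (enc x)

/-- A transition that is marked at `w` leads to the state `q`. -/
def Reaches (ρ : Assignment) (w : List ℕ) (q : M.Q) : Prop :=
  ∃ x : M.Transition, w ∈ ρ.so (enc x) ∧ M.tgt x.2 = q

/-- The transition `y` is a possible successor of the transition `x` at the `i`-th subtree. -/
def Compatible (i : ℕ) (x y : M.Transition) : Prop :=
  ∃ h : i < A.rk x.1, M.src x.2 ⟨i, h⟩ = M.tgt y.2

/-- All pairs of a position and a successor in the subtree at `w` are marked by compatible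
transitions. -/
def Consistent (ρ : Assignment) (w : List ℕ) (ξ : RTree A) : Prop :=
  ∀ u ∈ ξ.pos, ∀ i, u ++ [i + 1] ∈ ξ.pos → ∃ x y : M.Transition,
    M.Compatible i x y ∧ w ++ u ∈ ρ.so (enc x) ∧ w ++ u ++ [i + 1] ∈ ρ.so (enc y)

variable {enc} {M}

theorem consistent_node {ρ : Assignment} {w : List ℕ} {a : A.carrier}
    {c : Fin (A.rk a) → RTree A} {τ : M.T a}
    (hτ : ∀ x : M.Transition, w ∈ ρ.so (enc x) ↔ x = ⟨a, τ⟩) :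
    M.Consistent enc ρ w (RTree.node a c) ↔ ∀ i : Fin (A.rk a),
      M.Consistent enc ρ (w ++ [i.val + 1]) (c i) ∧
        M.Reaches enc ρ (w ++ [i.val + 1]) (M.src τ i) := by
  constructor
  · intro h i
    constructor
    · intro u hu j hj
      simpa using h ((i.val + 1) :: u) (RTree.cons_mem_pos_node.2 hu) j
        (RTree.cons_mem_pos_node.2 hj)
    · obtain ⟨x, y, ⟨hi, hxy⟩, hx, hy⟩ := h [] (RTree.nil_mem_pos _) i
        (RTree.cons_mem_pos_node.2 (RTree.nil_mem_pos _))
      simp only [List.append_nil] at hx hy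
      obtain rfl := (hτ x).1 hx
      exact ⟨y, hy, hxy.symm⟩
  · intro h u hu j hj
    rcases RTree.mem_pos_node.1 hu with rfl | ⟨i, u, hu', rfl⟩
    · rcases RTree.mem_pos_node.1 hj with h' | ⟨i, u, hu, h'⟩
      · cases h'
      · rw [List.nil_append, List.cons.injEq, Nat.add_right_cancel_iff] at h'
        obtain ⟨rfl, -⟩ := h'
        obtain ⟨y, hy, hyi⟩ := (h i).2
        exact ⟨⟨a, τ⟩, y, ⟨i.2, hyi.symm⟩, by simpa using (hτ _).2 rfl, by simpa using hy⟩
    · simpa using (h i).1 u hu' j (RTree.cons_mem_pos_node.1 hj)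

variable [Fintype A.carrier]

variable (M) (enc)

/-- The variables that stand for transitions. -/
def codes : Finset Var := Finset.univ.image (M.code enc)

variable {enc}

theorem code_mem_codes (x : M.Transition) : M.code enc x ∈ M.codes enc :=
  Finset.mem_image_of_mem _ (Finset.mem_univ _)

variable (enc)

open Classical in
/-- The automaton on trees with marks for transitions that uses a transition `τ` only if, as far as
the variables in `J` are concerned, the node is marked by the code of `τ` and nothing else. -/
noncomputable abbrev checked (J : Set Var) : WTA (A.ext (M.codes enc)) K where
  Q := M.Q
  T a := M.T a.1
  fintypeT a := M.fintypeT a.1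
  src τ := M.src τ
  tgt τ := M.tgt τ
  op {a} τ := if ∀ u : M.codes enc, u.1 ∈ J → (u ∈ a.2 ↔ u.1 = M.code enc ⟨a.1, τ⟩) then M.op τ
    else fun _ => 0
  op_mem {a} τ := by
    split_ifs
    · exact M.op_mem τ
    · exact CompleteMMonoid.zero_mem _

theorem val_checked_of_disjoint {J : Set Var} (hJ : ∀ u ∈ M.codes enc, u ∉ J) (ρ : Assignment)
    (ξ : RTree A) : ∀ w q, (M.checked enc J).val (ξ.encode (M.codes enc) ρ w) q = M.val ξ q := by
  classical
  induction ξ with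
  | node a c ih =>
    intro w q
    rw [RTree.encode, val_node, val_node]
    have h : ∀ u : M.codes enc, (u.1 ∈ J) = False := fun u => eq_false (hJ u u.2)
    simp only [ih, h, false_imp_iff, implies_true, if_true]

/-- Guessing the marks for one variable undoes the check of this variable. -/
theorem val_checked_guess {J J' : Set Var} {v : Var} (hv : v ∈ M.codes enc) (hvJ : v ∉ J)
    (hJ : ∀ u, u ∈ J' ↔ u = v ∨ u ∈ J) (t : RTree (A.ext (M.codes enc))) (q : M.Q) :
    ((M.checked enc J').guess v).val t q = (M.checked enc J).val t q := by
  classical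
  induction t generalizing q with
  | node a c ih =>
    have key : ∀ (b : Bool) (τ : M.T a.1),
        (∀ u : M.codes enc, u.1 ∈ J' →
          (u ∈ RTree.setMark v (b = true) a.2 ↔ u.1 = M.code enc ⟨a.1, τ⟩)) ↔
        (b = decide (v = M.code enc ⟨a.1, τ⟩)) ∧
          ∀ u : M.codes enc, u.1 ∈ J → (u ∈ a.2 ↔ u.1 = M.code enc ⟨a.1, τ⟩) := by
      intro b τ
      constructor
      · intro h
        constructor
        · have := h ⟨v, hv⟩ ((hJ v).2 (Or.inl rfl))
          simp only [RTree.setMark, Set.mem_ofPred_eq, true_and, ne_eq, not_true_eq_false,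
            false_and, or_false] at this
          rw [Bool.eq_iff_iff, decide_eq_true_iff, this]
        · intro u hu
          have huv : u.1 ≠ v := fun e => hvJ (e ▸ hu)
          simpa [RTree.setMark, huv] using h u ((hJ u).2 (Or.inr hu))
      · rintro ⟨rfl, h⟩ u hu
        by_cases huv : u.1 = v
        · simp [RTree.setMark, huv]
        · simpa [RTree.setMark, huv] using h u (((hJ u).1 hu).resolve_left huv)
    have hc : ∀ i, ((M.checked enc J').guess v).val (c i) = (M.checked enc J).val (c i) :=
      fun i => funext (ih i)
    rw [val_node, val_node]
    refine (Fintype.sum_sigma _).trans ?_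
    change (∑ b : Bool, ∑ τ : M.T a.1, if M.tgt τ = q then
      (M.checked enc J').op (a := (a.1, RTree.setMark v (b = true) a.2)) τ
        (fun i => ((M.checked enc J').guess v).val (c i) (M.src τ i)) else 0) = _
    rw [Finset.sum_comm]
    refine Finset.sum_congr rfl fun τ _ => ?_
    simp only [key, hc]
    rw [Fintype.sum_eq_single (decide (v = M.code enc ⟨a.1, τ⟩))]
    · simp only [true_and]
    · intro b hb
      simp only [hb, false_and, if_false, ite_self]

open Classical in
/-- The operations of the homomorphism that evaluates a tree with marks for transitions. -/
noncomputable def runOp (a : (A.ext (M.codes enc)).carrier) :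
    Ops (K := K) ((A.ext (M.codes enc)).rk a) :=
  if h : ∃ τ : M.T a.1, ∀ u : M.codes enc, u ∈ a.2 ↔ u.1 = M.code enc ⟨a.1, τ⟩ then
    ⟨M.op h.choose, M.op_mem _⟩
  else ⟨fun _ => 0, CompleteMMonoid.zero_mem _⟩

variable {enc}

theorem runOp_eq (henc : Function.Injective enc) {a : (A.ext (M.codes enc)).carrier} {τ : M.T a.1}
    (hτ : ∀ u : M.codes enc, u ∈ a.2 ↔ u.1 = M.code enc ⟨a.1, τ⟩) :
    (M.runOp enc a).1 = M.op τ := by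
  have h : ∃ τ : M.T a.1, ∀ u : M.codes enc, u ∈ a.2 ↔ u.1 = M.code enc ⟨a.1, τ⟩ := ⟨τ, hτ⟩
  have hh : h.choose = τ := by
    have := (hτ ⟨_, M.code_mem_codes ⟨a.1, h.choose⟩⟩).1 ((h.choose_spec _).2 rfl)
    exact eq_of_heq (Sigma.mk.inj (henc (Sum.inr.inj this))).2
  rw [runOp, dif_pos h]
  change M.op h.choose = M.op τ
  rw [hh]

variable {M}

theorem marks_iff_of_singleton (henc : Function.Injective enc) {ρ : Assignment} {w : List ℕ}
    {x : M.Transition}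
    (h : ∀ u : M.codes enc, u ∈ {v : M.codes enc | ρ.Marks w v} ↔ u.1 = M.code enc x)
    (y : M.Transition) : w ∈ ρ.so (enc y) ↔ y = x := by
  have := h ⟨_, M.code_mem_codes y⟩
  refine this.trans ⟨fun e => henc (Sum.inr.inj e), fun e => by rw [e]⟩

open Classical in
/-- When all variables are checked, at most one run is left, namely the one that is given by the
marks. -/
theorem val_checked_univ (henc : Function.Injective enc) (ρ : Assignment) (ξ : RTree A) :
    ∀ w q, (M.checked enc Set.univ).val (ξ.encode (M.codes enc) ρ w) q =
      if M.Consistent enc ρ w ξ ∧ M.Reaches enc ρ w q then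
        (ξ.encode (M.codes enc) ρ w).hom fun a => (M.runOp enc a).1 else 0 := by
  induction ξ with
  | node a c ih =>
    intro w q
    rw [RTree.encode, val_node, RTree.hom]
    simp only [Set.mem_univ, true_imp_iff]
    by_cases h : ∃ τ : M.T a, ∀ u : M.codes enc,
        u ∈ {v : M.codes enc | ρ.Marks w v} ↔ u.1 = M.code enc ⟨a, τ⟩
    · obtain ⟨τ, hτ⟩ := h
      have hm := marks_iff_of_singleton henc hτ
      rw [M.runOp_eq henc (a := (a, {v : M.codes enc | ρ.Marks w v})) hτ,
        Fintype.sum_eq_single τ, if_pos hτ]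
      · have hr : M.Reaches enc ρ w q ↔ M.tgt τ = q := by
          simp [Reaches, hm]
        rw [consistent_node hm, hr]
        by_cases hq : M.tgt τ = q
        · rw [if_pos hq]
          by_cases hc : ∀ i : Fin (A.rk a), M.Consistent enc ρ (w ++ [i.val + 1]) (c i) ∧
              M.Reaches enc ρ (w ++ [i.val + 1]) (M.src τ i)
          · rw [if_pos ⟨hc, hq⟩]
            congr 1
            funext i
            exact (ih i _ _).trans (if_pos (hc i))
          · rw [if_neg fun h => hc h.1]
            obtain ⟨i, hi⟩ := not_forall.1 hc
            exact apply_zero_of_mem_Ops (M.op_mem τ) i ((ih i _ _).trans (if_neg hi))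
        · rw [if_neg hq, if_neg fun h => hq h.2]
      · intro τ' hτ'
        have : ¬ ∀ u : M.codes enc, u ∈ {v : M.codes enc | ρ.Marks w v} ↔
            u.1 = M.code enc ⟨a, τ'⟩ := by
          intro h'
          have := (hm ⟨a, τ'⟩).1 ((marks_iff_of_singleton henc h' _).2 rfl)
          exact hτ' (eq_of_heq (Sigma.mk.inj this).2)
        rw [if_neg this, ite_self]
    · have h₁ : (M.runOp enc (a, {v : M.codes enc | ρ.Marks w v})).1 = fun _ => 0 := by
        rw [runOp, dif_neg h]
      rw [h₁, ite_self]
      refine Finset.sum_eq_zero fun τ _ => ?_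
      rw [if_neg fun h' => h ⟨τ, h'⟩, ite_self]

theorem runOp_eq_zero_or_reaches (henc : Function.Injective enc) (ρ : Assignment) (ξ : RTree A)
    (w : List ℕ) :
    ((ξ.encode (M.codes enc) ρ w).hom fun a => (M.runOp enc a).1) = 0 ∨
      ∃ q₀, ∀ q, M.Reaches enc ρ w q ↔ q₀ = q := by
  rcases ξ with ⟨a, c⟩
  by_cases h : ∃ τ : M.T a, ∀ u : M.codes enc,
      u ∈ {v : M.codes enc | ρ.Marks w v} ↔ u.1 = M.code enc ⟨a, τ⟩
  · obtain ⟨τ, hτ⟩ := h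
    exact Or.inr ⟨M.tgt τ, fun q => by simp [Reaches, marks_iff_of_singleton henc hτ]⟩
  · left
    rw [RTree.encode, RTree.hom, runOp, dif_neg h]

open Classical in
theorem series_checked_univ (henc : Function.Injective enc) (F : Set M.Q) (ρ : Assignment)
    (ξ : RTree A) :
    (M.checked enc Set.univ).series F (ξ.encode (M.codes enc) ρ []) =
      if M.Consistent enc ρ [] ξ ∧ ∃ q ∈ F, M.Reaches enc ρ [] q then
        (ξ.encode (M.codes enc) ρ []).hom fun a => (M.runOp enc a).1 else 0 := by
  rw [series]
  simp only [val_checked_univ henc]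
  rcases M.runOp_eq_zero_or_reaches henc ρ ξ [] with h | ⟨q₀, hq₀⟩
  · simp only [h, ite_self, Finset.sum_const_zero]
  · simp only [hq₀]
    rw [Fintype.sum_eq_single q₀]
    · by_cases hF : q₀ ∈ F <;> simp [hF]
    · intro q hq
      simp [Ne.symm hq]

variable (M) (enc)

/-- The formula for consistency. -/
noncomputable def consistentFormula : MSO A :=
  (MSO.disjOver (fun _ : Fin A.maxrk => True) fun i =>
    .existsFO 0 (.existsFO 1 ((MSO.edge i 0 1).and
      (MSO.disjOver (fun p : M.Transition × M.Transition => M.Compatible i p.1 p.2) fun p =>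
        (MSO.mem 0 (enc p.1)).and (MSO.mem 1 (enc p.2))).not))).not

/-- The formula that says that the transition at the root leads to a state in `F`. -/
noncomputable def rootFormula (F : Set M.Q) : MSO A :=
  .existsFO 0 ((MSO.disjOver (fun _ : Fin A.maxrk => True) fun i =>
      .existsFO 1 (MSO.edge i 1 0)).not.and
    (MSO.disjOver (fun x : M.Transition => M.tgt x.2 ∈ F) fun x => MSO.mem 0 (enc x)))

theorem models_consistentFormula (ξ : RTree A) (ρ : Assignment) :
    (M.consistentFormula enc).Models ξ ρ ↔ M.Consistent enc ρ [] ξ := by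
  have h : (M.consistentFormula enc).Models ξ ρ ↔
      ∀ i : Fin A.maxrk, ∀ u ∈ ξ.pos, u ++ [i.val + 1] ∈ ξ.pos → ∃ x y : M.Transition,
        M.Compatible i x y ∧ u ∈ ρ.so (enc x) ∧ u ++ [i.val + 1] ∈ ρ.so (enc y) := by
    simp [consistentFormula, MSO.Models, MSO.models_disjOver, Assignment.updFO]
  rw [h]
  constructor
  · intro h u hu i hi
    rcases ξ.eq_nil_or_eq_concat _ hi with h' | ⟨u', hu', j, h'⟩
    · simp at h'
    · have hij : i = j := by
        have := List.append_inj_right' h' rfl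
        simpa using this
      subst hij
      exact h j u hu hi
  · intro h i u hu hu'
    exact h u hu i hu'

theorem models_rootFormula (F : Set M.Q) (ξ : RTree A) (ρ : Assignment) :
    (M.rootFormula enc F).Models ξ ρ ↔ ∃ q ∈ F, M.Reaches enc ρ [] q := by
  have h : (M.rootFormula enc F).Models ξ ρ ↔
      ∃ w ∈ ξ.pos, (∀ i : Fin A.maxrk, ∀ u ∈ ξ.pos, w ≠ u ++ [i.val + 1]) ∧
        ∃ x : M.Transition, M.tgt x.2 ∈ F ∧ w ∈ ρ.so (enc x) := by
    simp [rootFormula, MSO.Models, MSO.models_disjOver, Assignment.updFO]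
  rw [h]
  constructor
  · rintro ⟨w, hw, hw', x, hx, hwx⟩
    rcases ξ.eq_nil_or_eq_concat _ hw with rfl | ⟨u, hu, i, h⟩
    · exact ⟨_, hx, x, hwx, rfl⟩
    · exact absurd h (hw' i u hu)
  · rintro ⟨_, hq, x, hx, rfl⟩
    exact ⟨[], RTree.nil_mem_pos _, by simp, x, hq, hx⟩

theorem free_consistentFormula : (M.consistentFormula enc).free ⊆ M.codes enc := by
  refine MSO.free_disjOver_subset _ _ fun i => ?_
  have h : (MSO.disjOver (fun p : M.Transition × M.Transition => M.Compatible i p.1 p.2) fun p =>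
        (MSO.mem (A := A) 0 (enc p.1)).and (MSO.mem 1 (enc p.2))).free ⊆
      insert (Sum.inl 0) (insert (Sum.inl 1) (M.codes enc)) := by
    refine MSO.free_disjOver_subset _ _ fun p => ?_
    have h₁ := M.code_mem_codes (enc := enc) p.1
    have h₂ := M.code_mem_codes (enc := enc) p.2
    intro v
    simp only [MSO.free, Finset.mem_union, Finset.mem_insert, Finset.mem_singleton]
    rintro ((rfl | rfl) | (rfl | rfl)) <;> tauto
  intro v
  simp only [MSO.free, Finset.mem_erase, Finset.mem_union, Finset.mem_insert,
    Finset.mem_singleton]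
  rintro ⟨h₀, h₁, (h' | h') | h'⟩
  · exact absurd h' h₀
  · exact absurd h' h₁
  · simpa [h₀, h₁] using h h'

theorem free_rootFormula (F : Set M.Q) : (M.rootFormula enc F).free ⊆ M.codes enc := by
  have h₁ : (MSO.disjOver (fun _ : Fin A.maxrk => True) fun i =>
      (.existsFO 1 (MSO.edge i 1 0) : MSO A)).free ⊆ {Sum.inl 0} := by
    refine MSO.free_disjOver_subset _ _ fun i v => ?_
    simp only [MSO.free, Finset.mem_erase, Finset.mem_insert, Finset.mem_singleton]
    tauto
  have h₂ : (MSO.disjOver (fun x : M.Transition => M.tgt x.2 ∈ F) fun x =>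
      (MSO.mem 0 (enc x) : MSO A)).free ⊆ insert (Sum.inl 0) (M.codes enc) := by
    refine MSO.free_disjOver_subset _ _ fun x v => ?_
    have h := M.code_mem_codes (enc := enc) x
    simp only [MSO.free, Finset.mem_insert, Finset.mem_singleton]
    rintro (rfl | rfl) <;> tauto
  intro v
  simp only [rootFormula, MSO.free, Finset.mem_erase, Finset.mem_union]
  rintro ⟨h₀, h | h⟩
  · exact absurd (Finset.mem_singleton.1 (h₁ h)) h₀
  · exact (Finset.mem_insert.1 (h₂ h)).resolve_left h₀

end WTA

section

variable {A : RankedAlphabet} {K : Type u} [CompleteMMonoid K]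

/-- Iterated sum over second-order variables. -/
def MExp.sumList (e : MExp A K) : List ℕ → MExp A K
  | [] => e
  | X :: l => sumSO X (sumList e l)

theorem MExp.free_sumList (e : MExp A K) (l : List ℕ) (v : Var) :
    v ∈ (e.sumList l).free ↔ v ∈ e.free ∧ v ∉ l.map Sum.inr := by
  induction l with
  | nil => simp [sumList]
  | cons X l ih =>
    simp only [sumList, free, Finset.mem_erase, ih, List.map_cons, List.mem_cons]
    tauto

theorem WTA.eval_sumList (hK : Compressible K) (M : WTA A K) [Fintype A.carrier]
    {enc : M.Transition → ℕ} (F : Set M.Q) {e : MExp A K} {ξ : RTree A}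
    (he : ∀ ρ, e.eval ξ ρ = (M.checked enc Set.univ).series F (ξ.encode (M.codes enc) ρ []))
    (l : List ℕ) (hl : l.Nodup) (hl' : ∀ X ∈ l, Sum.inr X ∈ M.codes enc) (ρ : Assignment) :
    (e.sumList l).eval ξ ρ = (M.checked enc {v | v ∉ l.map Sum.inr}).series F
      (ξ.encode (M.codes enc) ρ []) := by
  classical
  induction l generalizing ρ with
  | nil =>
    have : {v : Var | v ∉ List.map Sum.inr []} = Set.univ := by
      ext v
      simp
    rw [this]
    exact he ρ
  | cons X l ih =>
    obtain ⟨hX, hl⟩ := List.nodup_cons.1 hl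
    simp only [MExp.sumList, MExp.eval,
      ih hl fun Y hY => hl' Y (List.mem_cons_of_mem _ hY), series]
    rw [Finset.sum_comm]
    refine Finset.sum_congr rfl fun q _ => ?_
    rw [Finset.sum_ite_irrel, Finset.sum_const_zero]
    refine if_congr Iff.rfl ?_ rfl
    simp only [← RTree.mark_encode_updSO]
    have h := val_guess hK (M.checked enc {v | v ∉ l.map Sum.inr}) (Sum.inr X)
      (ξ.encode (M.codes enc) ρ []) q
    rw [RTree.pos_encode] at h
    rw [← h]
    refine M.val_checked_guess enc (hl' X List.mem_cons_self) (by simp) (fun u => ?_) _ q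
    by_cases hu : u = Sum.inr X
    · subst hu
      exact ⟨fun _ => Or.inl rfl, fun _ h => hX (by simpa using h)⟩
    · simp [hu]

theorem RecognizableSeries.exists_sentence (hK : Compressible K) {s : RTree A → K}
    (hs : RecognizableSeries s) : ∃ e : MExp A K, e.IsSentence ∧ e.sem = s := by
  classical
  obtain ⟨M, F, hM⟩ := hs
  let _ : Fintype A.carrier := Fintype.ofFinite _
  obtain ⟨enc, henc⟩ : ∃ enc : M.Transition → ℕ, Function.Injective enc :=
    exists_injective_nat _
  let e₀ : MExp A K := .guard ((M.consistentFormula enc).and (M.rootFormula enc F))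
    (.H (M.codes enc) (M.runOp enc))
  have he₀ : ∀ ξ ρ, e₀.eval ξ ρ =
      (M.checked enc Set.univ).series F (ξ.encode (M.codes enc) ρ []) := by
    intro ξ ρ
    rw [WTA.series_checked_univ henc]
    exact if_congr (and_congr (M.models_consistentFormula enc ξ ρ)
      (M.models_rootFormula enc F ξ ρ)) rfl rfl
  let l : List ℕ := Finset.univ.toList.map enc
  have hl : ∀ v, v ∈ M.codes enc ↔ v ∈ l.map Sum.inr := by
    intro v
    simp [l, WTA.codes]
  refine ⟨e₀.sumList l, ?_, ?_⟩
  · refine Finset.eq_empty_of_forall_notMem fun v hv => ?_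
    obtain ⟨hv, hvl⟩ := (e₀.free_sumList l v).1 hv
    refine hvl ((hl v).1 ?_)
    refine Finset.union_subset (Finset.union_subset ?_ ?_) subset_rfl hv
    · exact M.free_consistentFormula enc
    · exact M.free_rootFormula enc F
  · funext ξ
    rw [MExp.sem, M.eval_sumList hK F (he₀ ξ) l
      ((Finset.nodup_toList _).map henc) (fun X hX => (hl _).2 (List.mem_map_of_mem hX)), hM,
      WTA.series, WTA.series]
    refine Finset.sum_congr rfl fun q _ => if_congr Iff.rfl ?_ rfl
    -- All transition variables are bound, so no variable of the alphabet is checked.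
    exact M.val_checked_of_disjoint enc (J := {v | v ∉ l.map Sum.inr}) (fun u hu h => h ((hl u).1 hu)) _ ξ [] q

end

/-! ### Definability of M-expressions with the trivial storage type -/

section Lift

variable {D A : RankedAlphabet} (sel : A.carrier → D.carrier) (hsel : ∀ a, D.rk (sel a) = A.rk a)

/-- The symbol `⟨d, a⟩` for the selected symbol `d`. -/
abbrev liftSymbol (a : A.carrier) : (extension D A).carrier := Sum.inr ⟨(sel a, a), hsel a⟩

/-- The tree above `ξ` that has no chains and only contains selected symbols. -/
abbrev RTree.lift (ξ : RTree A) : RTree (extension D A) :=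
  ξ.map (liftSymbol sel hsel) fun _ => rfl

theorem RTree.strip_lift (ξ : RTree A) : (ξ.lift sel hsel).strip = ξ := by
  induction ξ with
  | node a c ih => exact congrArg (node a) (funext ih)

theorem RTree.pos_lift (ξ : RTree A) : (ξ.lift sel hsel).pos = ξ.pos := by
  induction ξ with
  | node a c ih =>
    change insert [] (Finset.univ.biUnion fun i : Fin (A.rk a) =>
      (pos (lift sel hsel (c i))).image (List.cons (i.val + 1))) = _
    simp only [ih, pos]

theorem RTree.labelAt_lift (ξ : RTree A) :
    ∀ w, (ξ.lift sel hsel).labelAt w = (ξ.labelAt w).map (liftSymbol sel hsel) := by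
  induction ξ with
  | node a c ih =>
    intro w
    match w with
    | [] => rfl
    | 0 :: w => rfl
    | (n + 1) :: w =>
      change (if h : n < A.rk a then (lift sel hsel (c ⟨n, h⟩)).labelAt w else none) = _
      rw [labelAt]
      split_ifs with h
      · exact ih _ w
      · rfl

/-- Some node is labelled by a symbol `⟨d, *⟩`. -/
def RTree.HasChain : RTree (extension D A) → Prop
  | node (Sum.inl _) _ => True
  | node (Sum.inr _) c => ∃ i, HasChain (c i)

variable {sel} in
theorem RTree.eq_lift_of_not_hasChain (huniq : ∀ a d, D.rk d = A.rk a → d = sel a)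
    (ζ : RTree (extension D A)) (h : ¬ ζ.HasChain) : ζ = ζ.strip.lift sel hsel := by
  induction ζ with
  | node b c ih =>
    rcases b with d | ⟨⟨d, a⟩, hd⟩
    · exact absurd trivial h
    · obtain rfl := huniq a d hd
      exact congrArg (node (A := extension D A) (Sum.inr ⟨(sel a, a), hd⟩))
        (funext fun i => ih i fun hi => h ⟨i, hi⟩)

/-- Every symbol of `A` occurs in a symbol of `⟨D, A⟩` of the same rank. -/
theorem maxrk_le_maxrk_extension (sel : A.carrier → D.carrier)
    (hsel : ∀ a, D.rk (sel a) = A.rk a) : A.maxrk ≤ (extension D A).maxrk :=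
  have : Nonempty A.carrier := A.exists_nullary.elim fun a _ => ⟨a⟩
  ciSup_le fun a =>
    le_ciSup (Set.finite_range (extension D A).rk).bddAbove (liftSymbol sel hsel a)

/-- The translation of a formula that is compatible with the lifting of trees. -/
noncomputable def MSO.lift : MSO A → MSO (extension D A)
  | label a x => label (liftSymbol sel hsel a) x
  | edge i x y => edge (i.castLE (maxrk_le_maxrk_extension sel hsel)) x y
  | mem x X => mem x X
  | not φ => not φ.lift
  | or φ ψ => or φ.lift ψ.lift
  | and φ ψ => and φ.lift ψ.lift
  | existsFO x φ => existsFO x φ.lift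
  | forallFO x φ => forallFO x φ.lift
  | existsSO X φ => existsSO X φ.lift
  | forallSO X φ => forallSO X φ.lift

theorem MSO.free_lift (φ : MSO A) : (φ.lift sel hsel).free = φ.free := by
  induction φ <;> simp_all [lift, free]

theorem MSO.models_lift (ξ : RTree A) (φ : MSO A) (ρ : Assignment) :
    (φ.lift sel hsel).Models (ξ.lift sel hsel) ρ ↔ φ.Models ξ ρ := by
  induction φ generalizing ρ with
  | label a x =>
    simp only [lift, Models, RTree.labelAt_lift, Option.map_eq_some_iff]
    simp
  | edge i x y => rfl
  | mem x X => rfl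
  | not φ ih => exact not_congr (ih ρ)
  | or φ ψ ih₁ ih₂ => exact or_congr (ih₁ ρ) (ih₂ ρ)
  | and φ ψ ih₁ ih₂ => exact and_congr (ih₁ ρ) (ih₂ ρ)
  | existsFO x φ ih => simp only [lift, Models, RTree.pos_lift, ih]
  | forallFO x φ ih => simp only [lift, Models, RTree.pos_lift, ih]
  | existsSO X φ ih => simp only [lift, Models, RTree.pos_lift, ih]
  | forallSO X φ ih => simp only [lift, Models, RTree.pos_lift, ih]

variable {K : Type u} [CompleteMMonoid K]

/-- The operations `ω`, extended by the constant zero operation at the symbols `⟨d, *⟩`. -/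
def liftOp {U : Finset Var} (ω : (a : (A.ext U).carrier) → Ops (K := K) ((A.ext U).rk a)) :
    (b : ((extension D A).ext U).carrier) → Ops (K := K) (((extension D A).ext U).rk b)
  | (Sum.inl _, _) => ⟨fun _ => 0, CompleteMMonoid.zero_mem 1⟩
  | (Sum.inr q, V) => ω (q.val.2, V)

/-- The translation of an M-expression that is compatible with the lifting of trees and yields zero
on trees with chains. -/
noncomputable def MExp.lift : MExp A K → MExp (extension D A) K
  | H U ω => H U (liftOp ω)
  | add e₁ e₂ => add e₁.lift e₂.lift
  | guard φ e => guard (φ.lift sel hsel) e.lift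
  | sumFO x e => sumFO x e.lift
  | sumSO X e => sumSO X e.lift

theorem MExp.free_lift (e : MExp A K) : (e.lift sel hsel).free = e.free := by
  induction e <;> simp_all [lift, free, MSO.free_lift]

theorem hom_liftOp {U : Finset Var}
    (ω : (a : (A.ext U).carrier) → Ops (K := K) ((A.ext U).rk a)) (ρ : Assignment) (ξ : RTree A) :
    ∀ w, ((ξ.lift sel hsel).encode U ρ w).hom (fun b => (liftOp (D := D) ω b).1) =
      (ξ.encode U ρ w).hom fun a => (ω a).1 := by
  induction ξ with
  | node a c ih =>
    intro w
    exact congrArg (ω (a, {v : U | ρ.Marks w v})).1 (funext fun i => ih i _)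

theorem hom_liftOp_eq_zero {U : Finset Var}
    (ω : (a : (A.ext U).carrier) → Ops (K := K) ((A.ext U).rk a)) (ρ : Assignment)
    (ζ : RTree (extension D A)) (h : ζ.HasChain) :
    ∀ w, (ζ.encode U ρ w).hom (fun b => (liftOp (D := D) ω b).1) = 0 := by
  induction ζ with
  | node b c ih =>
    intro w
    rcases b with d | q
    · rfl
    · obtain ⟨i, hi⟩ := h
      exact apply_zero_of_mem_Ops (liftOp ω (Sum.inr q, {v : U | ρ.Marks w v})).2 i (ih i hi _)

theorem MExp.eval_lift (ξ : RTree A) (e : MExp A K) (ρ : Assignment) :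
    (e.lift sel hsel).eval (ξ.lift sel hsel) ρ = e.eval ξ ρ := by
  classical
  induction e generalizing ρ with
  | H U ω => exact hom_liftOp sel hsel ω ρ ξ []
  | add e₁ e₂ ih₁ ih₂ => simp only [lift, eval, ih₁, ih₂]
  | guard φ e ih => exact if_congr (MSO.models_lift sel hsel ξ φ ρ) (ih ρ) rfl
  | sumFO x e ih => simp only [lift, eval, RTree.pos_lift, ih]
  | sumSO X e ih => simp only [lift, eval, RTree.pos_lift, ih]

theorem MExp.eval_lift_eq_zero (ζ : RTree (extension D A)) (h : ζ.HasChain) (e : MExp A K)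
    (ρ : Assignment) : (e.lift sel hsel).eval ζ ρ = 0 := by
  induction e generalizing ρ with
  | H U ω => exact hom_liftOp_eq_zero ω ρ ζ h []
  | add e₁ e₂ ih₁ ih₂ => simp only [lift, eval, ih₁, ih₂, add_zero]
  | guard φ e ih => simp only [lift, eval, ih, ite_self]
  | sumFO x e ih => simp only [lift, eval, ih, Finset.sum_const_zero]
  | sumSO X e ih => simp only [lift, eval, ih, Finset.sum_const_zero]

theorem MExp.definable_TRIV {e : MExp A K} (he : e.IsSentence) : Definable TRIV e.sem := by
  let P' : Finset (TRIV.C → Bool) := {fun _ => true}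
  let F' : Finset (TRIV.C → Option TRIV.C) := {fun c => some c}
  have hP : P'.Nonempty := Finset.singleton_nonempty _
  have hF : F'.Nonempty := Finset.singleton_nonempty _
  have hP' : (P' : Set (TRIV.C → Bool)) ⊆ TRIV.P := (Finset.coe_singleton _).subset
  have hF' : (F' : Set (TRIV.C → Option TRIV.C)) ⊆ TRIV.F := (Finset.coe_singleton _).subset
  let sel : A.carrier → (corresponding A.maxrk P' F' hP).carrier := fun a =>
    ⟨⟨A.rk a, Nat.lt_succ_of_le (le_ciSup (Set.finite_range A.rk).bddAbove a)⟩,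
      ⟨_, Finset.mem_singleton_self _⟩, fun _ => ⟨_, Finset.mem_singleton_self _⟩⟩
  have hsel : ∀ a, (corresponding A.maxrk P' F' hP).rk (sel a) = A.rk a := fun _ => rfl
  -- Since there is only one predicate and one instruction, symbols are determined by their rank.
  have huniq : ∀ a d, (corresponding A.maxrk P' F' hP).rk d = A.rk a → d = sel a := by
    rintro a ⟨⟨k, hk⟩, p, f⟩ rfl
    have hP₁ : Subsingleton P' := ⟨fun p p' => Subtype.ext
      ((Finset.mem_singleton.1 p.2).trans (Finset.mem_singleton.1 p'.2).symm)⟩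
    have hF₁ : Subsingleton F' := ⟨fun f f' => Subtype.ext
      ((Finset.mem_singleton.1 f.2).trans (Finset.mem_singleton.1 f'.2).symm)⟩
    exact Sigma.ext rfl (heq_of_eq (Subsingleton.elim _ _))
  refine ⟨P', F', hP, hF, hP', hF', e.lift sel hsel, (e.free_lift sel hsel).trans he, ?_⟩
  funext ξ
  rw [compose_behavioursOn_TRIV hP' hF', csum_eq_single _ ⟨ξ.lift sel hsel, ξ.strip_lift sel hsel⟩]
  · exact e.eval_lift sel hsel ξ _
  · rintro ⟨ζ, hζ⟩ hne
    refine MExp.eval_lift_eq_zero sel hsel ζ (by_contra fun h => hne (Subtype.ext ?_)) e _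
    have := ζ.eq_lift_of_not_hasChain hsel huniq h
    rwa [hζ] at this

end Lift

end WTL

theorem mainTheorem10 {K : Type u} [WTL.CompleteMMonoid K] (A : WTL.RankedAlphabet)
    (s : WTL.RTree A → K) :
    ((∃ e : WTL.MExp A K, e.IsSentence ∧ e.sem = s) → WTL.Definable WTL.TRIV s) ∧
    (WTL.Compressible K → WTL.Definable WTL.TRIV s →
      ∃ e : WTL.MExp A K, e.IsSentence ∧ e.sem = s) := by
  constructor
  · rintro ⟨e, he, rfl⟩
    exact e.definable_TRIV he
  · exact fun hK hs => (hs.recognizableSeries hK).exists_sentence hK
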